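/- For $E\subset\mathbb{R}^2$ and $0\le r_-\le r_+$ let $$\mathcal{S}^1_{r_-,r_+}(E)=\inf\sum_{B\in\mathcal{B}}\operatorname{diam}(B),$$ the infimum being over all at most countable collections $\mathcal{B}$ of open balls of radius in $[r_-,r_+]$ that cover $E$, and let $\mathcal{S}^1(E)=\lim_{r_+\to0^+}\mathcal{S}^1_{0,r_+}(E)$. Let $m$ be Lebesgue measure on $\mathbb{R}$ and $\sigma$ normalised arclength measure on the unit circle $S^1\subset\mathbb{R}^2$, and define the Favard length $$\operatorname{Fav}(E)=(m\times\sigma)\bigl(\{(c,\omega)\in\mathbb{R}\times S^1:\ x\cdot\omega=c\text{ for some }x\in E\}\bigr).$$ For $\varepsilon,r,M>0$ let $$R_E(\varepsilon,r,M)=\sup\frac{m(\{x\in J:\ x\omega_1+(F(x)+y)\omega_2\in E\text{ for some }-\varepsilon\le y\le\varepsilon\})}{m(J)},$$ where the supremum is over all orthonormal $\omega_1,\omega_2\in S^1$, all $F:\mathbb{R}\to\mathbb{R}$ with Lipschitz constant at most $M$, and all bounded intervals $J\subset\mathbb{R}$ of length at least $r$. **Theorem.** There is an absolute constant $C>0$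 such that the following holds. Let $L>0$, let $E\subset\mathbb{R}^2$ be a compact subset of the closed unit ball with $\mathcal{S}^1(E)\le L$, let $N\ge1$ be an integer, and let $$0<r_{N,-}\le r_{N,+}\le\dots\le r_{1,-}\le r_{1,+}\le1$$ be scales such that 1. (uniform length bound) $\mathcal{S}^1_{r_{n,-},r_{n,+}}(E)\le L$ for all $1\le n\le N$; 2. (scale separation) $r_{n+1,+}\le\frac12 r_{n,-}$ for all $1\le n<N$; 3. (unrectifiability) $R_E\bigl(r_{n+1,+},\,r_{n,-},\,1/r_{n,-}\bigr)\le N^{-1/100}$ for all $1\le n<N$. Then $\operatorname{Fav}(E)\le C\,N^{-1/100}L$. -/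

import Mathlib

open MeasureTheory Filter
open scoped ENNReal Topology

noncomputable section

namespace Besicovitch

/-- The Euclidean plane. -/
abbrev Plane : Type := EuclideanSpace ℝ (Fin 2)

/-- The unit circle in the plane. -/
abbrev UnitCircle : Type := Metric.sphere (0 : Plane) 1

/-- An at most countable collection of open balls covering `E`, all of radius in `[rminus, rplus]`.
A ball is recorded as the pair (centre, radius). -/
def IsBallCover (rminus rplus : ℝ) (E : Set Plane) (B : Set (Plane × ℝ)) : Prop :=
  B.Countable ∧ (∀ b ∈ B, rminus ≤ b.2 ∧ b.2 ≤ rplus) ∧ E ⊆ ⋃ b ∈ B, Metric.ball b.1 b.2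

/-- The one-dimensional restricted spherical content: the infimum of the sums of the diameters
over all at most countable covers of `E` by open balls of radius in `[rminus, rplus]`. -/
def sphericalContent (rminus rplus : ℝ) (E : Set Plane) : ℝ≥0∞ :=
  ⨅ (B : Set (Plane × ℝ)) (_ : IsBallCover rminus rplus E B),
    ∑' b : B, Metric.ediam (Metric.ball b.1.1 b.1.2)

/-- The one-dimensional spherical measure. The content `sphericalContent 0 ρ E` increases as `ρ`
decreases, so its limit as `ρ → 0+` is the supremum over `ρ > 0`;
see `tendsto_sphericalContent`. -/
def sphericalMeasure (E : Set Plane) : ℝ≥0∞ :=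
  ⨆ (ρ : ℝ) (_ : 0 < ρ), sphericalContent 0 ρ E

theorem sphericalContent_anti (E : Set Plane) : Antitone fun ρ : ℝ => sphericalContent 0 ρ E := by
  intro ρ ρ' h
  refine le_iInf₂ fun B hB => iInf₂_le B ?_
  exact ⟨hB.1, fun b hb => ⟨(hB.2.1 b hb).1, (hB.2.1 b hb).2.trans h⟩, hB.2.2⟩

theorem tendsto_sphericalContent (E : Set Plane) :
    Tendsto (fun ρ : ℝ => sphericalContent 0 ρ E) (𝓝[>] 0) (𝓝 (sphericalMeasure E)) := by
  refine tendsto_order.2 ⟨fun a ha => ?_, fun a ha => ?_⟩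
  · obtain ⟨ρ, hρ⟩ := lt_iSup_iff.1 ha
    obtain ⟨h0, hρ⟩ := lt_iSup_iff.1 hρ
    filter_upwards [Ioc_mem_nhdsGT h0] with t ht
    exact hρ.trans_le (sphericalContent_anti E ht.2)
  · filter_upwards [self_mem_nhdsWithin] with t ht
    exact (le_iSup₂ (f := fun (ρ : ℝ) (_ : 0 < ρ) => sphericalContent 0 ρ E) t ht).trans_lt ha

/-- Normalised arclength measure on the unit circle. -/
def circleMeasure : Measure UnitCircle :=
  (ENNReal.ofReal (2 * Real.pi))⁻¹ • Measure.hausdorffMeasure 1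

/-- The line `{x : x · ω = c}`. -/
def dualLine (c : ℝ) (ω : UnitCircle) : Set Plane :=
  {x | inner ℝ x (ω : Plane) = c}

/-- The Favard length of a subset of `ℝ² × S¹`. -/
def favardLift (A : Set (Plane × UnitCircle)) : ℝ≥0∞ :=
  ((volume : Measure ℝ).prod circleMeasure)
    {p : ℝ × UnitCircle | ((dualLine p.1 p.2 ×ˢ {p.2}) ∩ A).Nonempty}

/-- The Favard length of a subset of the plane. -/
def favard (E : Set Plane) : ℝ≥0∞ :=
  favardLift (E ×ˢ Set.univ)

/-- The set of parameters `x ∈ J` for which `E` meets the vertical segment of half-length `ε`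
about the point over `x` of the graph of `F` in the coordinates given by `ω₁`, `ω₂`. -/
def nearGraph (E : Set Plane) (ε : ℝ) (ω₁ ω₂ : Plane) (F : ℝ → ℝ) (J : Set ℝ) : Set ℝ :=
  {x ∈ J | ∃ y : ℝ, -ε ≤ y ∧ y ≤ ε ∧ x • ω₁ + (F x + y) • ω₂ ∈ E}

/-- The rectifiability constant `R_E(ε, r, M)`: the supremum ranges over all orthonormal pairs
`ω₁, ω₂`, all functions `F` with Lipschitz constant at most `M`, and all intervals `J = [a, b]` of
length at least `r` (endpoints do not affect the ratio). -/
def rectConst (E : Set Plane) (ε r M : ℝ) : ℝ≥0∞ :=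
  ⨆ (ω₁ : Plane) (ω₂ : Plane) (_ : ‖ω₁‖ = 1 ∧ ‖ω₂‖ = 1 ∧ inner ℝ ω₁ ω₂ = 0)
    (F : ℝ → ℝ) (_ : ∀ x y, |F x - F y| ≤ M * |x - y|)
    (a : ℝ) (b : ℝ) (_ : r ≤ b - a),
    volume (nearGraph E ε ω₁ ω₂ F (Set.Icc a b)) / volume (Set.Icc a b)

end Besicovitch

end

/-! Let μ be one-dimensional Hausdorff measure on `E`, of mass at most Λ, and describe a line by its
offset and the angle of its normal. `fav` measures the lines attached to a set of point-direction
pairs; it is subadditive and at most twice mass times measure of directions on products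
(`fav_prod_le`). `fav_le_of_scale` splits the pairs over `E` into four classes.

Dirty pairs: some dyadic cone or strip about the direction has mass above `K` times its width. Then
the projection of μ has a large maximal function at the line, and the weak-type inequality bounds
these lines by O(Λ/K) (`fav_dirtySet_le`). Boundary pairs, whose direction is near an end of its
dyadic interval, are few. Clean pairs: inside one ball of a cover, points seeing no other point of
the set in a narrowed cone lie near a Lipschitz graph, so their projection is controlled by
unrectifiability (`volume_pr_image_le_rectConst`); the others have small mass by a Vitali argument
(`measure_points_with_cone_le`).

Bad pairs, where a non-dirty cone still has density above `lam` in the annulus of the scale, are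
what needs many scales. While directions stay clean they carry density at most `K`, so a
stopping-time argument (`le_volume_of_gaps`) shows that a proportion at least `lam / (2K)` of the
directions in a bad cell either become dirty by a fine generation `P`, or stay clean and hit `E` in
the annulus. Dirty sets grow with the generation, so in some block of consecutive scales the new
dirt is small. In that block, pairs hitting fewer than `k` annuli are counted fewer than `k` times,
so some scale sees few of them; pairs hitting at least `k` annuli project to points covered `k`
times by projected balls, a set of length O(Λ/k), and cleanness turns this into mass O(KΛ/k)
(`measure_multSet_slice_le`).

With `D = ⌊N^(1/100)⌋`, `K = D`, `lam = D⁻²`, `k = D ^ 6` and `D ^ 12 + 1` blocks of as many scales,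
every class contributes O(Λ/D). This consumes O(D^25) of the given scales, fewer than `N`. -/

namespace Besicovitch

/-! ### Coordinates along a rotating direction. -/

/-- The unit vector at angle `2πt`. -/
noncomputable def dir (t : ℝ) : Plane := !₂[Real.cos (2 * Real.pi * t), Real.sin (2 * Real.pi * t)]

/-- The coordinate of `x` along `dir t`. -/
noncomputable def pr (x : Plane) (t : ℝ) : ℝ :=
  x 0 * Real.cos (2 * Real.pi * t) + x 1 * Real.sin (2 * Real.pi * t)

/-- The unit vector at angle `2πt + π/2`. -/
noncomputable def perp (t : ℝ) : Plane :=
  !₂[-Real.sin (2 * Real.pi * t), Real.cos (2 * Real.pi * t)]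

/-- The coordinate of `x` along `perp t`. -/
noncomputable def prp (x : Plane) (t : ℝ) : ℝ :=
  -(x 0 * Real.sin (2 * Real.pi * t)) + x 1 * Real.cos (2 * Real.pi * t)

theorem inner_dir (x : Plane) (t : ℝ) : inner ℝ x (dir t) = pr x t := by
  simp [dir, pr, PiLp.inner_apply, Fin.sum_univ_two, mul_comm]

theorem norm_sq_plane (x : Plane) : ‖x‖ ^ 2 = x 0 ^ 2 + x 1 ^ 2 := by
  simp [EuclideanSpace.norm_sq_eq, Fin.sum_univ_two]

theorem norm_dir (t : ℝ) : ‖dir t‖ = 1 := by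
  have h := norm_sq_plane (dir t)
  simp only [dir, PiLp.toLp_apply, Matrix.cons_val_zero, Matrix.cons_val_one] at h
  rw [Real.cos_sq_add_sin_sq] at h
  exact (pow_eq_one_iff_of_nonneg (norm_nonneg _) two_ne_zero).1 h

theorem norm_perp (t : ℝ) : ‖perp t‖ = 1 := by
  have h := norm_sq_plane (perp t)
  simp only [perp, PiLp.toLp_apply, Matrix.cons_val_zero, Matrix.cons_val_one, neg_sq] at h
  rw [Real.sin_sq_add_cos_sq] at h
  exact (pow_eq_one_iff_of_nonneg (norm_nonneg _) two_ne_zero).1 h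

theorem inner_dir_perp (t : ℝ) : inner ℝ (dir t) (perp t) = 0 := by
  simp [dir, perp, PiLp.inner_apply, Fin.sum_univ_two]; ring

theorem pr_smul_add_prp_smul (x : Plane) (t : ℝ) : pr x t • dir t + prp x t • perp t = x := by
  have h := Real.sin_sq_add_cos_sq (2 * Real.pi * t)
  ext i
  fin_cases i
  · simp [pr, prp, dir, perp]; linear_combination x 0 * h
  · simp [pr, prp, dir, perp]; linear_combination x 1 * h

theorem pr_sub (x y : Plane) (t : ℝ) : pr (x - y) t = pr x t - pr y t := by
  simp [pr]; ring

theorem prp_sub (x y : Plane) (t : ℝ) : prp (x - y) t = prp x t - prp y t := by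
  simp [prp]; ring

theorem pr_sq_add_prp_sq (x : Plane) (t : ℝ) : pr x t ^ 2 + prp x t ^ 2 = ‖x‖ ^ 2 := by
  have h := Real.sin_sq_add_cos_sq (2 * Real.pi * t)
  rw [norm_sq_plane]; simp only [pr, prp]
  linear_combination (x 0 ^ 2 + x 1 ^ 2) * h

theorem abs_pr_le (x : Plane) (t : ℝ) : |pr x t| ≤ ‖x‖ := by
  apply abs_le.2 (abs_le_of_sq_le_sq' _ (norm_nonneg x))
  nlinarith [pr_sq_add_prp_sq x t, sq_nonneg (prp x t)]

theorem abs_prp_le (x : Plane) (t : ℝ) : |prp x t| ≤ ‖x‖ := by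
  apply abs_le.2 (abs_le_of_sq_le_sq' _ (norm_nonneg x))
  nlinarith [pr_sq_add_prp_sq x t, sq_nonneg (pr x t)]

theorem abs_pr_sub_pr_le (x y : Plane) (t : ℝ) : |pr x t - pr y t| ≤ dist x y := by
  rw [← pr_sub, dist_eq_norm]; exact abs_pr_le _ _

theorem norm_dir_sub_dir_le (s t : ℝ) : ‖dir s - dir t‖ ≤ 2 * Real.pi * |s - t| := by
  have h1 := norm_sq_plane (dir s - dir t)
  have h2 := Real.one_sub_sq_div_two_le_cos (x := 2 * Real.pi * s - 2 * Real.pi * t)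
  rw [Real.cos_sub] at h2
  simp only [dir, PiLp.sub_apply, Matrix.cons_val_zero, Matrix.cons_val_one] at h1
  have h3 := Real.sin_sq_add_cos_sq (2 * Real.pi * s)
  have h4 := Real.sin_sq_add_cos_sq (2 * Real.pi * t)
  refine (abs_le_of_sq_le_sq' ?_ (by positivity)).2
  rw [mul_pow, sq_abs]
  unfold dir
  nlinarith

theorem abs_pr_sub_param_le (x : Plane) (s t : ℝ) : |pr x s - pr x t| ≤ 7 * |s - t| * ‖x‖ := by
  rw [← inner_dir, ← inner_dir, ← inner_sub_right]
  refine (abs_real_inner_le_norm _ _).trans ?_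
  rw [mul_comm]
  have := norm_dir_sub_dir_le s t
  have hpi := Real.pi_lt_d2
  gcongr
  refine this.trans ?_
  gcongr
  linarith

theorem pr_add_param (x : Plane) (t h : ℝ) :
    pr x (t + h) = pr x t * Real.cos (2 * Real.pi * h) + prp x t * Real.sin (2 * Real.pi * h) := by
  simp only [pr, prp, mul_add, Real.cos_add, Real.sin_add]; ring

/-- The values at `t - h` and `t + h` multiply to `pr² cos² - prp² sin²`, which is nonpositive
because `sin (2πh) ≥ 4h`; then apply the intermediate value theorem. This converts a bound on a
projection into membership in a cone. -/
theorem exists_pr_eq_zero (v : Plane) {t h : ℝ} (h0 : 0 ≤ h) (h1 : h ≤ 1 / 4)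
    (hv : |pr v t| ≤ h * ‖v‖) : ∃ s ∈ Set.Icc (t - h) (t + h), pr v s = 0 := by
  have hpi := Real.pi_pos
  have hs : 4 * h ≤ Real.sin (2 * Real.pi * h) := by
    have := Real.mul_le_sin (x := 2 * Real.pi * h) (by positivity) (by nlinarith)
    calc 4 * h = 2 / Real.pi * (2 * Real.pi * h) := by field_simp; ring
      _ ≤ _ := this
  have hn := norm_nonneg v
  have hprod : pr v (t - h) * pr v (t + h) ≤ 0 := by
    rw [sub_eq_add_neg, pr_add_param, pr_add_param, mul_neg, Real.cos_neg, Real.sin_neg]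
    have e := pr_sq_add_prp_sq v t
    have hc := Real.sin_sq_add_cos_sq (2 * Real.pi * h)
    have hg : pr v t ^ 2 ≤ (h * ‖v‖) ^ 2 :=
      sq_le_sq.2 (by rwa [abs_of_nonneg (by positivity : 0 ≤ h * ‖v‖)])
    have hs2 : (4 * h) ^ 2 ≤ Real.sin (2 * Real.pi * h) ^ 2 := by gcongr
    have hcos : Real.cos (2 * Real.pi * h) ^ 2 ≤ 1 := by nlinarith
    have hh : h ^ 2 ≤ 1 / 16 := by nlinarith
    have hp : ‖v‖ ^ 2 * (1 / 2) ≤ prp v t ^ 2 := by nlinarith [sq_nonneg ‖v‖]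
    have a1 : pr v t ^ 2 * Real.cos (2 * Real.pi * h) ^ 2 ≤ (h * ‖v‖) ^ 2 * 1 := by gcongr
    have a2 : ‖v‖ ^ 2 * (1 / 2) * (4 * h) ^ 2 ≤ prp v t ^ 2 * Real.sin (2 * Real.pi * h) ^ 2 := by
      gcongr
    nlinarith [sq_nonneg (h * ‖v‖)]
  have hcont : ContinuousOn (fun s => pr v s) (Set.uIcc (t - h) (t + h)) := by
    unfold pr; fun_prop
  have h0' : (0 : ℝ) ∈ Set.uIcc (pr v (t - h)) (pr v (t + h)) := by
    rw [Set.mem_uIcc]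
    rcases mul_nonpos_iff.1 hprod with h | h
    · exact Or.inr ⟨h.2, h.1⟩
    · exact Or.inl h
  obtain ⟨s, hs, hs0⟩ := intermediate_value_uIcc hcont h0'
  exact ⟨s, by rwa [Set.uIcc_of_le (by linarith)] at hs, hs0⟩

/-! ### From the circle to angles; lines attached to point-direction pairs. -/

/-- The point of the unit circle at angle `2πt`. -/
noncomputable def circ (t : ℝ) : UnitCircle := ⟨dir t, by simp [norm_dir]⟩

theorem lipschitzWith_circ : LipschitzWith (Real.toNNReal (2 * Real.pi)) circ := by
  refine LipschitzWith.of_dist_le_mul fun s t => ?_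
  rw [Subtype.dist_eq, dist_eq_norm, Real.dist_eq, Real.coe_toNNReal _ (by positivity)]
  exact norm_dir_sub_dir_le s t

theorem exists_circ_eq (ω : UnitCircle) : ∃ t ∈ Set.Ico (0 : ℝ) 1, circ t = ω := by
  have hω : ‖(ω : Plane)‖ = 1 := by simp
  have h1 := norm_sq_plane (ω : Plane)
  rw [hω] at h1
  set z : ℂ := ⟨(ω : Plane) 0, (ω : Plane) 1⟩ with hz
  have hn : ‖z‖ = 1 := by
    rw [Complex.norm_eq_sqrt_sq_add_sq]; simp only [hz]; rw [← h1]; simp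
  have hz0 : z ≠ 0 := by intro h; simp [h] at hn
  refine ⟨Int.fract (z.arg / (2 * Real.pi)), ⟨Int.fract_nonneg _, Int.fract_lt_one _⟩, ?_⟩
  have harg : 2 * Real.pi * Int.fract (z.arg / (2 * Real.pi)) =
      z.arg - ⌊z.arg / (2 * Real.pi)⌋ * (2 * Real.pi) := by
    rw [Int.fract]; field_simp
  apply Subtype.ext
  ext i
  fin_cases i
  · change Real.cos (2 * Real.pi * Int.fract (z.arg / (2 * Real.pi))) = (ω : Plane) 0
    rw [harg, Real.cos_sub_int_mul_two_pi, Complex.cos_arg hz0, hn, div_one]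
  · change Real.sin (2 * Real.pi * Int.fract (z.arg / (2 * Real.pi))) = (ω : Plane) 1
    rw [harg, Real.sin_sub_int_mul_two_pi, Complex.sin_arg, hn, div_one]

/-- The parametrisation maps `[0, 1)` onto the circle and is 2π-Lipschitz; this constant cancels the
normalisation. Only the upper bound is needed. -/
theorem circleMeasure_le :
    circleMeasure ≤ (volume.restrict (Set.Ico (0 : ℝ) 1)).map circ := by
  refine Measure.le_iff.2 fun A hA => ?_
  have hm : Measurable circ := lipschitzWith_circ.continuous.measurable
  rw [Measure.map_apply hm hA, Measure.restrict_apply (hm hA), circleMeasure, Measure.smul_apply,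
    smul_eq_mul]
  have hsub : A ⊆ circ '' (circ ⁻¹' A ∩ Set.Ico 0 1) := by
    intro ω hω
    obtain ⟨t, ht, rfl⟩ := exists_circ_eq ω
    exact ⟨t, ⟨hω, ht⟩, rfl⟩
  have h2 := lipschitzWith_circ.hausdorffMeasure_image_le (d := 1) zero_le_one
    (circ ⁻¹' A ∩ Set.Ico 0 1)
  rw [ENNReal.rpow_one, hausdorffMeasure_real] at h2
  calc _ ≤ (ENNReal.ofReal (2 * Real.pi))⁻¹ * (ENNReal.ofReal (2 * Real.pi) *
        volume (circ ⁻¹' A ∩ Set.Ico 0 1)) := by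
        gcongr; exact (measure_mono hsub).trans h2
    _ = _ := by
        rw [← mul_assoc, ENNReal.inv_mul_cancel _ ENNReal.ofReal_ne_top, one_mul]
        simp [Real.pi_pos]

/-- The set of lines, in the parametrisation `(c, t)`, passing through a point of the pairs. -/
def lines (A : Set (Plane × ℝ)) : Set (ℝ × ℝ) := Set.image (fun p => (pr p.1 p.2, p.2)) A

/-- The Favard length of a set of point-direction pairs. -/
noncomputable def fav (A : Set (Plane × ℝ)) : ℝ≥0∞ := volume (lines A)

theorem fav_mono {A B : Set (Plane × ℝ)} (h : A ⊆ B) : fav A ≤ fav B :=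
  measure_mono (Set.image_mono h)

theorem fav_union_le (A B : Set (Plane × ℝ)) : fav (A ∪ B) ≤ fav A + fav B := by
  unfold fav lines
  rw [Set.image_union]; exact measure_union_le _ _

theorem fav_biUnion_le {ι : Type*} (s : Finset ι) (A : ι → Set (Plane × ℝ)) :
    fav (⋃ i ∈ s, A i) ≤ ∑ i ∈ s, fav (A i) := by
  unfold fav lines
  rw [Set.image_iUnion₂]; exact measure_biUnion_finset_le _ _

theorem fav_iUnion_le (A : ℕ → Set (Plane × ℝ)) : fav (⋃ i, A i) ≤ ∑' i, fav (A i) := by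
  unfold fav lines
  rw [Set.image_iUnion]; exact measure_iUnion_le _

/-- Compactness makes the set of lines closed, hence measurable, so its pushforward measure is that
of a preimage. -/
theorem favard_le_fav {E : Set Plane} (hE : IsCompact E) :
    favard E ≤ fav (E ×ˢ Set.Ico 0 1) := by
  set S : Set (ℝ × UnitCircle) := (fun p : Plane × UnitCircle => (inner ℝ p.1 (p.2 : Plane), p.2)) ''
    (E ×ˢ Set.univ) with hS
  have hSc : IsCompact S := (hE.prod isCompact_univ).image (by fun_prop)
  have hSm : MeasurableSet S := hSc.isClosed.measurableSet
  have h0 : favard E = ((volume : Measure ℝ).prod circleMeasure) S := by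
    unfold favard favardLift
    congr 1
    ext ⟨c, ω⟩
    simp only [dualLine, Set.mem_ofPred_eq, Set.Nonempty, Set.mem_inter_iff, Set.mem_prod,
      Set.mem_singleton_iff, Set.mem_univ, hS, Set.mem_image, Prod.exists, Prod.mk.injEq, and_true]
    constructor
    · rintro ⟨x, ω', ⟨h1, rfl⟩, h2⟩; exact ⟨x, ω', h2, h1, rfl⟩
    · rintro ⟨x, ω', h2, h1, rfl⟩; exact ⟨x, ω', ⟨h1, rfl⟩, h2⟩
  have hm : Measurable circ := lipschitzWith_circ.continuous.measurable
  rw [h0]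
  calc _ ≤ ((volume : Measure ℝ).prod ((volume.restrict (Set.Ico (0 : ℝ) 1)).map circ)) S :=
        Measure.prod_mono le_rfl circleMeasure_le S
    _ = volume ((Prod.map id circ) ⁻¹' S ∩ (Set.univ ×ˢ Set.Ico (0 : ℝ) 1)) := by
        have h1 := Measure.map_prod_map (volume : Measure ℝ)
          (volume.restrict (Set.Ico (0 : ℝ) 1)) measurable_id hm
        have h2 := Measure.prod_restrict (μ := (volume : Measure ℝ)) (ν := (volume : Measure ℝ))
          Set.univ (Set.Ico (0 : ℝ) 1)
        rw [Measure.restrict_univ] at h2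
        rw [Measure.map_id] at h1
        rw [h1, Measure.map_apply (measurable_id.prodMap hm) hSm, h2,
          Measure.restrict_apply ((measurable_id.prodMap hm) hSm), Measure.volume_eq_prod]
    _ ≤ _ := by
        refine measure_mono ?_
        rintro ⟨c, t⟩ ⟨⟨⟨x, ω⟩, hx, he⟩, -, ht⟩
        simp only [Prod.map_apply, id_eq, Prod.mk.injEq] at he
        refine ⟨(x, t), ⟨hx.1, ht⟩, ?_⟩
        simp only [Prod.mk.injEq, and_true]
        rw [← he.1, he.2, ← inner_dir]; rfl

/-! ### Favard length against Hausdorff measure. -/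

theorem volume_le_mul_of_slice_le {S : Set (ℝ × ℝ)} (hS : MeasurableSet S) {Θ : Set ℝ}
    (hΘ : MeasurableSet Θ) {b : ℝ≥0∞} (hsub : ∀ p ∈ S, p.2 ∈ Θ)
    (h : ∀ t ∈ Θ, volume {c | (c, t) ∈ S} ≤ b) : volume S ≤ b * volume Θ := by
  rw [Measure.volume_eq_prod, Measure.prod_apply_symm hS, ← setLIntegral_const,
    ← lintegral_indicator hΘ]
  refine lintegral_mono fun t => ?_
  by_cases ht : t ∈ Θ
  · rw [Set.indicator_of_mem ht]; exact h t ht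
  · rw [Set.indicator_of_notMem ht]
    refine le_of_eq ?_
    convert measure_empty (μ := (volume : Measure ℝ))
    ext c
    exact ⟨fun hc => ht (hsub _ hc), fun hc => hc.elim⟩

/-- In each direction a set of diameter `d` projects into an interval of length `2d`. Summing over
the covers that define Hausdorff measure allows arbitrary, possibly non-measurable `A`. -/
theorem fav_prod_le (A : Set Plane) {Θ : Set ℝ} (hΘ : MeasurableSet Θ) (hfin : volume Θ ≠ ∞) :
    fav (A ×ˢ Θ) ≤ 2 * (μH[1] A * volume Θ) := by
  have key : ∀ U : Set Plane, Metric.ediam U ≤ 1 →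
      fav (U ×ˢ Θ) ≤ (⨆ (_ : U.Nonempty), Metric.ediam U ^ (1 : ℝ)) * (2 * volume Θ) := by
    intro U hU
    rcases U.eq_empty_or_nonempty with rfl | hne
    · simp [fav, lines]
    have hd : Metric.ediam U ≠ ∞ := ne_top_of_le_ne_top ENNReal.one_ne_top hU
    simp only [hne, ciSup_unique, ENNReal.rpow_one]
    obtain ⟨x0, hx0⟩ := hne
    have hb : Bornology.IsBounded U := Metric.isBounded_iff_ediam_ne_top.2 hd
    set S : Set (ℝ × ℝ) := {p | |p.1 - pr x0 p.2| ≤ Metric.diam U ∧ p.2 ∈ Θ} with hS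
    have hSm : MeasurableSet S := by
      refine MeasurableSet.inter ?_ (measurable_snd hΘ)
      have hc : Continuous fun p : ℝ × ℝ => |p.1 - pr x0 p.2| := by unfold pr; fun_prop
      exact measurableSet_le hc.measurable measurable_const
    calc fav (U ×ˢ Θ) ≤ volume S := by
          refine measure_mono ?_
          rintro _ ⟨⟨x, t⟩, ⟨hx, ht⟩, rfl⟩
          exact ⟨(abs_pr_sub_pr_le x x0 t).trans (Metric.dist_le_diam_of_mem hb hx hx0), ht⟩
      _ ≤ (2 * Metric.ediam U) * volume Θ := by
          refine volume_le_mul_of_slice_le hSm hΘ (fun p hp => hp.2) fun t ht => ?_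
          calc volume {c | (c, t) ∈ S} ≤ volume (Metric.closedBall (pr x0 t) (Metric.diam U)) := by
                refine measure_mono fun c hc => ?_
                rw [Metric.mem_closedBall, Real.dist_eq]; exact hc.1
            _ = 2 * Metric.ediam U := by
                rw [Real.volume_closedBall, ENNReal.ofReal_mul zero_le_two, Metric.diam,
                  ENNReal.ofReal_toReal hd]; simp
      _ = _ := by ring
  have h2 : (2 * volume Θ) ≠ ∞ := ENNReal.mul_ne_top (by simp) hfin
  rcases eq_or_ne (volume Θ) 0 with h0 | h0
  · have hz : volume (Prod.snd ⁻¹' Θ : Set (ℝ × ℝ)) = 0 := by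
      have := volume_le_mul_of_slice_le (measurable_snd hΘ) hΘ (b := ∞) (fun p hp => hp)
        (fun _ _ => le_top)
      simpa [h0] using this
    refine (measure_mono_null ?_ hz).le.trans bot_le
    rintro _ ⟨⟨x, t⟩, ⟨hx, ht⟩, rfl⟩
    exact ht
  have h3 : fav (A ×ˢ Θ) / (2 * volume Θ) ≤ μH[1] A := by
    rw [Measure.hausdorffMeasure_apply]
    refine le_trans ?_ (le_iSup₂ (1 : ℝ≥0∞) one_pos)
    refine le_iInf fun t => le_iInf fun hAt => le_iInf fun ht => ?_
    refine ENNReal.div_le_of_le_mul ?_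
    rw [← ENNReal.tsum_mul_right]
    calc fav (A ×ˢ Θ) ≤ fav (⋃ n, t n ×ˢ Θ) := by
          refine fav_mono ?_
          rw [← Set.iUnion_prod_const]
          exact Set.prod_mono hAt le_rfl
      _ ≤ _ := (fav_iUnion_le _).trans (ENNReal.tsum_le_tsum fun n => key _ (ht n))
  have := (ENNReal.div_le_iff (by simp [h0]) h2).1 h3
  calc _ ≤ _ := this
    _ = _ := by ring

/-- Doubling `L` only creates the strict inequality from which covers by arbitrarily small balls are
extracted. -/
theorem hausdorffMeasure_le_of_sphericalMeasure_le {E : Set Plane} {L : ℝ} (hL : 0 < L)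
    (h : sphericalMeasure E ≤ ENNReal.ofReal L) : μH[1] E ≤ ENNReal.ofReal (2 * L) := by
  have hlt : ENNReal.ofReal L < ENNReal.ofReal (2 * L) :=
    (ENNReal.ofReal_lt_ofReal_iff (by linarith)).2 (by linarith)
  have hc : ∀ n : ℕ, ∃ B : Set (Plane × ℝ), IsBallCover 0 (1 / ((n : ℝ) + 1)) E B ∧
      ∑' b : B, Metric.ediam (Metric.ball b.1.1 b.1.2) < ENNReal.ofReal (2 * L) := by
    intro n
    have hn : (0 : ℝ) < 1 / ((n : ℝ) + 1) := Nat.one_div_pos_of_nat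
    have h1 : sphericalContent 0 (1 / ((n : ℝ) + 1)) E < ENNReal.ofReal (2 * L) :=
      ((le_iSup₂ (f := fun (ρ : ℝ) (_ : 0 < ρ) => sphericalContent 0 ρ E) _ hn).trans h).trans_lt
        hlt
    obtain ⟨B, hB⟩ := iInf_lt_iff.1 h1
    obtain ⟨hB, hB'⟩ := iInf_lt_iff.1 hB
    exact ⟨B, hB, hB'⟩
  choose B hB hsum using hc
  have : ∀ n, Countable (B n) := fun n => (hB n).1.to_subtype
  have hr : Tendsto (fun n : ℕ => ENNReal.ofReal (2 * (1 / ((n : ℝ) + 1)))) atTop (𝓝 0) := by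
    rw [← ENNReal.ofReal_zero]
    refine ENNReal.tendsto_ofReal ?_
    simpa using (tendsto_one_div_add_atTop_nhds_zero_nat (𝕜 := ℝ)).const_mul 2
  refine (Measure.hausdorffMeasure_le_liminf_tsum 1 E _ hr
    (fun n (b : B n) => Metric.ball b.1.1 b.1.2) (Eventually.of_forall fun n b => ?_)
    (Eventually.of_forall fun n => ?_)).trans ?_
  · refine Metric.ediam_le_of_forall_dist_le fun x hx y hy => ?_
    have := ((hB n).2.1 b b.2).2
    have h1 := dist_triangle_right x y b.1.1
    rw [Metric.mem_ball] at hx hy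
    linarith
  · rw [Set.iUnion_subtype]; exact (hB n).2.2
  · simp only [ENNReal.rpow_one]
    refine liminf_le_of_le (by isBoundedDefault) fun b hb => ?_
    obtain ⟨n, hn⟩ := hb.exists
    exact hn.trans (hsum n).le

/-! ### The weak-type maximal inequality. -/

theorem volume_iUnion_closedBall_le {u : Set (ℝ × ℝ)} (hu : u.Countable) (τ : ℝ≥0∞)
    {τ' : ℝ} (hτ' : 0 ≤ τ') (hτ : ENNReal.ofReal (2 * τ') ≤ τ) :
    volume (⋃ p ∈ u, Metric.closedBall p.1 (τ' * p.2)) ≤ ∑' p : u, τ * ENNReal.ofReal p.1.2 := by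
  refine (measure_biUnion_le _ hu _).trans (ENNReal.tsum_le_tsum fun p => ?_)
  rw [Real.volume_closedBall, ← mul_assoc, ENNReal.ofReal_mul (by positivity)]
  gcongr

/-- The weak-type maximal inequality on the line. -/
theorem volume_maximal_le (ν : Measure ℝ) [IsFiniteMeasure ν] {A : ℝ≥0∞} (h0 : A ≠ 0)
    (hA : A ≠ ∞) :
    volume {c : ℝ | ∃ w : ℚ, 0 < w ∧ A * ENNReal.ofReal w < ν (Metric.closedBall c w)} ≤
      10 * (ν Set.univ / A) := by
  set t : Set (ℝ × ℝ) := {p | 0 < p.2 ∧ A * ENNReal.ofReal p.2 < ν (Metric.closedBall p.1 p.2)}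
    with ht
  have hfin : ν Set.univ / A ≠ ∞ := ENNReal.div_ne_top (measure_ne_top _ _) h0
  have hR : ∀ p ∈ t, p.2 ≤ (ν Set.univ / A).toReal := by
    intro p hp
    rw [← ENNReal.ofReal_le_iff_le_toReal hfin, ENNReal.le_div_iff_mul_le (Or.inl h0) (Or.inl hA),
      mul_comm]
    exact hp.2.le.trans (measure_mono (Set.subset_univ _))
  obtain ⟨u, hut, hdisj, hcov⟩ := Vitali.exists_disjoint_subfamily_covering_enlargement_closedBall
    t Prod.fst Prod.snd _ hR 5 (by norm_num)
  have huc : u.Countable := by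
    refine hdisj.countable_of_nonempty_interior fun p hp => ?_
    rw [Real.closedBall_eq_Icc, interior_Icc]
    exact Set.nonempty_Ioo.2 (by linarith [(hut hp).1])
  calc _ ≤ volume (⋃ p ∈ u, Metric.closedBall p.1 (5 * p.2)) := by
        refine measure_mono ?_
        rintro c ⟨w, hw, hc⟩
        obtain ⟨b, hb, hsub⟩ := hcov (c, (w : ℝ)) ⟨Rat.cast_pos.2 hw, hc⟩
        refine Set.mem_biUnion hb (hsub (Metric.mem_closedBall_self ?_))
        exact Rat.cast_nonneg.2 hw.le
    _ ≤ ∑' p : u, 10 * ENNReal.ofReal p.1.2 :=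
        volume_iUnion_closedBall_le huc 10 (by norm_num) (by norm_num)
    _ ≤ ∑' p : u, 10 * (ν (Metric.closedBall p.1.1 p.1.2) / A) := by
        refine ENNReal.tsum_le_tsum fun p => ?_
        gcongr
        rw [ENNReal.le_div_iff_mul_le (Or.inl h0) (Or.inl hA), mul_comm]
        exact (hut p.2).2.le
    _ = 10 * ((∑' p : u, ν (Metric.closedBall p.1.1 p.1.2)) / A) := by
        simp only [div_eq_mul_inv]
        rw [ENNReal.tsum_mul_left, ENNReal.tsum_mul_right]
    _ ≤ _ := by
        gcongr
        rw [← measure_biUnion huc hdisj fun p _ => Metric.isClosed_closedBall.measurableSet]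
        exact measure_mono (Set.subset_univ _)

/-! ### Dyadic directions of high density. -/

/-- The closed dyadic interval of generation `q` and index `j`. -/
def dyad (q j : ℕ) : Set ℝ := Set.Icc ((j : ℝ) / 2 ^ q) (((j : ℝ) + 1) / 2 ^ q)

/-- The cone of points seen from `x` along a line with normal direction in a dyadic interval. -/
def cone (q j : ℕ) (x : Plane) : Set Plane := {y | ∃ t ∈ dyad q j, pr (y - x) t = 0}

/-- The union of the strips around `x` of half-width `2^{-q}` over the normal directions in
a dyadic interval. -/
def strip (q j : ℕ) (x : Plane) : Set Plane := {y | ∃ t ∈ dyad q j, |pr (y - x) t| ≤ 1 / 2 ^ q}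

/-- The dyadic interval is a high density direction at `x`. -/
def HighDensity (μ : Measure Plane) (K : ℝ≥0∞) (x : Plane) (q j : ℕ) : Prop :=
  (∃ r : ℚ, 0 < r ∧
    K * ENNReal.ofReal (r / 2 ^ q) < μ (cone q j x ∩ Metric.closedBall x r)) ∨
  K * ENNReal.ofReal (1 / 2 ^ q) < μ (strip q j x)

/-- The dyadic interval or one of its dyadic ancestors is a high density direction at `x`. -/
def Dirty (μ : Measure Plane) (K : ℝ≥0∞) (x : Plane) : ℕ → ℕ → Prop
  | 0, j => HighDensity μ K x 0 j
  | q + 1, j => Dirty μ K x q (j / 2) ∨ HighDensity μ K x (q + 1) j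

theorem floor_pow_succ_div_two (q : ℕ) (t : ℝ) : ⌊2 ^ (q + 1) * t⌋₊ / 2 = ⌊2 ^ q * t⌋₊ := by
  rw [← Nat.floor_div_ofNat]
  congr 1
  rw [pow_succ]; ring

theorem mem_dyad_floor (q : ℕ) {t : ℝ} (ht : 0 ≤ t) : t ∈ dyad q ⌊2 ^ q * t⌋₊ := by
  have h2 : (0 : ℝ) < 2 ^ q := by positivity
  refine ⟨?_, ?_⟩
  · rw [div_le_iff₀ h2, mul_comm]; exact Nat.floor_le (by positivity)
  · rw [le_div_iff₀ h2, mul_comm]; exact (Nat.lt_floor_add_one _).le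

theorem abs_sub_le_of_mem_dyad {q j : ℕ} {s t : ℝ} (hs : s ∈ dyad q j) (ht : t ∈ dyad q j) :
    |s - t| ≤ 1 / 2 ^ q := by
  have := abs_sub_le_of_le_of_le hs.1 hs.2 ht.1 ht.2
  rwa [← sub_div, add_sub_cancel_left] at this

theorem abs_pr_le_of_mem_cone {q j : ℕ} {x y : Plane} {t : ℝ} (ht : t ∈ dyad q j)
    (hy : y ∈ cone q j x) : |pr (y - x) t| ≤ 7 * (1 / 2 ^ q) * dist y x := by
  obtain ⟨s, hs, h0⟩ := hy
  have h1 := abs_pr_sub_param_le (y - x) t s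
  rw [h0, sub_zero, ← dist_eq_norm] at h1
  refine h1.trans ?_
  gcongr
  exact abs_sub_le_of_mem_dyad ht hs

theorem abs_pr_le_of_mem_strip {q j : ℕ} {x y : Plane} {t : ℝ} (ht : t ∈ dyad q j)
    (hy : y ∈ strip q j x) : |pr (y - x) t| ≤ 1 / 2 ^ q + 7 * (1 / 2 ^ q) * dist y x := by
  obtain ⟨s, hs, h0⟩ := hy
  have h1 := abs_pr_sub_param_le (y - x) t s
  rw [← dist_eq_norm] at h1
  have h2 : 7 * |t - s| * dist y x ≤ 7 * (1 / 2 ^ q) * dist y x := by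
    gcongr
    exact abs_sub_le_of_mem_dyad ht hs
  have h3 := abs_sub_abs_le_abs_sub (pr (y - x) t) (pr (y - x) s)
  linarith

theorem exists_highDensity_of_dirty {μ : Measure Plane} {K : ℝ≥0∞} {x : Plane} {q : ℕ} {t : ℝ}
    (h : Dirty μ K x q ⌊2 ^ q * t⌋₊) : ∃ q', HighDensity μ K x q' ⌊2 ^ q' * t⌋₊ := by
  induction q with
  | zero => exact ⟨0, h⟩
  | succ q ih =>
    rcases h with h | h
    · rw [floor_pow_succ_div_two] at h; exact ih h
    · exact ⟨_, h⟩

theorem not_highDensity_of_not_dirty {μ : Measure Plane} {K : ℝ≥0∞} {x : Plane} {q j : ℕ}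
    (h : ¬ Dirty μ K x q j) : ¬ HighDensity μ K x q j := by
  cases q with
  | zero => exact h
  | succ q => exact fun hq => h (Or.inr hq)

theorem dirty_mono {μ : Measure Plane} {K : ℝ≥0∞} {x : Plane} {q q' : ℕ} (hq : q ≤ q') {t : ℝ}
    (h : Dirty μ K x q ⌊2 ^ q * t⌋₊) : Dirty μ K x q' ⌊2 ^ q' * t⌋₊ := by
  induction q', hq using Nat.le_induction with
  | base => exact h
  | succ m _ ih => left; rwa [floor_pow_succ_div_two]

/-- The pairs whose direction is dirty at generation `q`. -/
def dirtySet (μ : Measure Plane) (K : ℝ≥0∞) (q : ℕ) : Set (Plane × ℝ) :=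
  {p | Dirty μ K p.1 q ⌊2 ^ q * p.2⌋₊}

/-- Either kind of high density squeezes mass into a thin band through `x`. Angles in the interval
differ by at most `1/2^q` and `pr` is `7‖·‖`-Lipschitz in the angle, so the cone up to radius `r`
projects within `7r/2^q` of `x`, and the strip inside the unit ball within `(1 + 7·2)/2^q`; hence
15. -/
theorem exists_rat_of_highDensity {μ : Measure Plane} {K : ℝ≥0∞} {E : Set Plane}
    (hE : E ⊆ Metric.closedBall 0 1) (hμ : μ Eᶜ = 0) {x : Plane} (hx : x ∈ E) {q : ℕ} {t : ℝ}
    (ht : 0 ≤ t) (h : HighDensity μ K x q ⌊2 ^ q * t⌋₊) :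
    ∃ w : ℚ, 0 < w ∧ K / 15 * ENNReal.ofReal w < μ {y | |pr y t - pr x t| ≤ w} := by
  have hK : ∀ a : ℝ, K / 15 * ENNReal.ofReal (15 * a) = K * ENNReal.ofReal a := by
    intro a
    rw [ENNReal.ofReal_mul (by norm_num), ← mul_assoc]
    congr 1
    rw [show ENNReal.ofReal 15 = 15 by simp]
    exact ENNReal.div_mul_cancel (by simp) (by simp)
  have htd := mem_dyad_floor q ht
  rcases h with ⟨r, hr, h⟩ | h
  · refine ⟨7 * r / 2 ^ q, by positivity, ?_⟩
    refine lt_of_le_of_lt ?_ (h.trans_le (measure_mono ?_))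
    · rw [← hK]
      gcongr
      push_cast
      rw [mul_div_assoc]
      have : (0 : ℝ) ≤ r / 2 ^ q := by positivity
      linarith
    · rintro y ⟨hy, hyr⟩
      have := abs_pr_le_of_mem_cone htd hy
      rw [Set.mem_ofPred_eq, ← pr_sub]
      refine this.trans ?_
      rw [Metric.mem_closedBall] at hyr
      push_cast
      calc 7 * (1 / 2 ^ q) * dist y x ≤ 7 * (1 / 2 ^ q) * (r : ℝ) := by gcongr
        _ = _ := by ring
  · refine ⟨15 / 2 ^ q, by positivity, ?_⟩
    refine lt_of_le_of_lt ?_ (h.trans_le ?_)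
    · rw [← hK]
      gcongr
      push_cast
      rw [mul_one_div]
    · rw [← measure_inter_conull hμ]
      refine measure_mono ?_
      rintro y ⟨hy, hyE⟩
      have := abs_pr_le_of_mem_strip htd hy
      rw [Set.mem_ofPred_eq, ← pr_sub]
      refine this.trans ?_
      have hd : dist y x ≤ 2 := by
        have h1 := hE hyE
        have h2 := hE hx
        rw [Metric.mem_closedBall] at h1 h2
        linarith [dist_triangle_right y x 0]
      push_cast
      calc 1 / 2 ^ q + 7 * (1 / 2 ^ q) * dist y x ≤ 1 / 2 ^ q + 7 * (1 / 2 ^ q) * 2 := by gcongr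
        _ = _ := by ring

/-- For each angle, the offsets of dirty lines lie where the maximal function of the projected
measure exceeds `K/15`. The bound is uniform in the generation, so a very fine one may be used
later. -/
theorem fav_dirtySet_le {μ : Measure Plane} [IsFiniteMeasure μ] {K : ℝ≥0∞} (h0 : K ≠ 0)
    (hK : K ≠ ∞) {E : Set Plane} (hE : E ⊆ Metric.closedBall 0 1) (hμ : μ Eᶜ = 0) (q : ℕ) :
    fav (E ×ˢ Set.Ico 0 1 ∩ dirtySet μ K q) ≤ 150 * (μ Set.univ / K) := by
  set S : Set (ℝ × ℝ) := {p | p.2 ∈ Set.Ico (0 : ℝ) 1 ∧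
    ∃ w : ℚ, 0 < w ∧ K / 15 * ENNReal.ofReal w < μ {y | |pr y p.2 - p.1| ≤ w}} with hS
  have hSm : MeasurableSet S := by
    refine MeasurableSet.inter (measurable_snd measurableSet_Ico) ?_
    have : {p : ℝ × ℝ | ∃ w : ℚ, 0 < w ∧
        K / 15 * ENNReal.ofReal w < μ {y | |pr y p.2 - p.1| ≤ w}} = ⋃ w : ℚ, ⋃ (_ : 0 < w),
        {p : ℝ × ℝ | K / 15 * ENNReal.ofReal w < μ {y | |pr y p.2 - p.1| ≤ w}} := by
      ext p; simp
    change MeasurableSet {p : ℝ × ℝ | ∃ w : ℚ, 0 < w ∧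
        K / 15 * ENNReal.ofReal w < μ {y | |pr y p.2 - p.1| ≤ w}}
    rw [this]
    refine MeasurableSet.iUnion fun w => MeasurableSet.iUnion fun _ => ?_
    refine measurableSet_lt measurable_const ?_
    have hc : Continuous fun z : (ℝ × ℝ) × Plane => |pr z.2 z.1.2 - z.1.1| := by
      unfold pr; fun_prop
    exact measurable_measure_prodMk_left
      (s := {z : (ℝ × ℝ) × Plane | |pr z.2 z.1.2 - z.1.1| ≤ w})
      (measurableSet_le hc.measurable measurable_const)
  have h15 : K / 15 ≠ 0 := by simp [h0]
  have h15' : K / 15 ≠ ∞ := ENNReal.div_ne_top hK (by simp)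
  calc _ ≤ volume S := by
        refine measure_mono ?_
        rintro _ ⟨⟨x, t⟩, ⟨⟨hx, ht⟩, hd⟩, rfl⟩
        obtain ⟨q', h'⟩ := exists_highDensity_of_dirty hd
        exact ⟨ht, exists_rat_of_highDensity hE hμ hx ht.1 h'⟩
    _ ≤ (10 * (μ Set.univ / (K / 15))) * volume (Set.Ico (0 : ℝ) 1) := by
        refine volume_le_mul_of_slice_le hSm measurableSet_Ico (fun p hp => hp.1) fun t ht => ?_
        have hm : Measurable fun y => pr y t := by
          have : Continuous fun y => pr y t := by unfold pr; fun_prop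
          exact this.measurable
        have := volume_maximal_le (μ.map fun y => pr y t) h15 h15'
        rw [Measure.map_apply hm MeasurableSet.univ, Set.preimage_univ] at this
        refine le_trans (measure_mono ?_) this
        rintro c ⟨-, w, hw, h⟩
        refine ⟨w, hw, ?_⟩
        rw [Measure.map_apply hm Metric.isClosed_closedBall.measurableSet]
        exact h
    _ = _ := by
        simp only [Real.volume_Ico, sub_zero, ENNReal.ofReal_one, mul_one, div_eq_mul_inv]
        rw [ENNReal.mul_inv (by simp) (by simp), inv_inv]
        calc _ = (10 * 15 : ℝ≥0∞) * (μ Set.univ * K⁻¹) := by ring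
          _ = _ := by norm_num

/-! ### Disjoint dyadic cells and the stopping-time argument. -/

/-- The half-open dyadic interval of generation `q` and index `j`. -/
def cell (q j : ℕ) : Set ℝ := Set.Ico ((j : ℝ) / 2 ^ q) (((j : ℝ) + 1) / 2 ^ q)

theorem mem_cell_iff {q j : ℕ} {t : ℝ} : t ∈ cell q j ↔ 0 ≤ t ∧ ⌊2 ^ q * t⌋₊ = j := by
  have h2 : (0 : ℝ) < 2 ^ q := by positivity
  have h3 : t ∈ cell q j ↔ (j : ℝ) ≤ 2 ^ q * t ∧ 2 ^ q * t < j + 1 := by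
    rw [cell, Set.mem_Ico, div_le_iff₀ h2, lt_div_iff₀ h2, mul_comm t]
  rw [h3]
  constructor
  · intro h
    have h0 : 0 ≤ 2 ^ q * t := (Nat.cast_nonneg j).trans h.1
    exact ⟨nonneg_of_mul_nonneg_right h0 h2, (Nat.floor_eq_iff h0).2 h⟩
  · rintro ⟨h0, h⟩
    exact (Nat.floor_eq_iff (by positivity)).1 h

theorem measurableSet_cell (q j : ℕ) : MeasurableSet (cell q j) := measurableSet_Ico

theorem volume_cell (q j : ℕ) : volume (cell q j) = ENNReal.ofReal (1 / 2 ^ q) := by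
  rw [cell, Real.volume_Ico, ← sub_div, add_sub_cancel_left]

theorem disjoint_cell {q i j : ℕ} (h : i ≠ j) : Disjoint (cell q i) (cell q j) := by
  rw [Set.disjoint_left]
  intro t h1 h2
  exact h ((mem_cell_iff.1 h1).2.symm.trans (mem_cell_iff.1 h2).2)

theorem cell_eq_union (q j : ℕ) : cell q j = cell (q + 1) (2 * j) ∪ cell (q + 1) (2 * j + 1) := by
  ext t
  simp only [Set.mem_union, mem_cell_iff, ← floor_pow_succ_div_two q t]
  constructor
  · rintro ⟨h, h'⟩
    rcases (show ⌊2 ^ (q + 1) * t⌋₊ = 2 * j ∨ ⌊2 ^ (q + 1) * t⌋₊ = 2 * j + 1 by omega) with h1 | h1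
    · exact Or.inl ⟨h, h1⟩
    · exact Or.inr ⟨h, h1⟩
  · rintro (⟨h, h'⟩ | ⟨h, h'⟩)
    · exact ⟨h, by omega⟩
    · exact ⟨h, by omega⟩

theorem cell_subset_Ico {q j : ℕ} (hj : j < 2 ^ q) : cell q j ⊆ Set.Ico 0 1 := by
  intro t ht
  refine ⟨(mem_cell_iff.1 ht).1, ht.2.trans_le ?_⟩
  rw [div_le_one (by positivity)]
  exact_mod_cast hj

theorem floor_lt_two_pow (q : ℕ) {t : ℝ} (ht : t ∈ Set.Ico (0 : ℝ) 1) : ⌊2 ^ q * t⌋₊ < 2 ^ q := by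
  rw [Nat.floor_lt (by have := ht.1; positivity)]
  push_cast
  have : (0 : ℝ) < 2 ^ q := by positivity
  nlinarith [ht.2]

theorem measurableSet_floor (q : ℕ) (X : ℕ → Prop) : MeasurableSet {t : ℝ | X ⌊2 ^ q * t⌋₊} := by
  have : Measurable fun t : ℝ => ⌊2 ^ q * t⌋₊ := (measurable_const.mul measurable_id).nat_floor
  exact this (MeasurableSet.of_discrete (s := {n | X n}))

theorem cell_subset_of_mono {D : ℕ → ℕ → Prop} (hD : ∀ q j, D q (j / 2) → D (q + 1) j) {q P j : ℕ}
    (hq : q ≤ P) (h : D q j) {t : ℝ} (ht : t ∈ cell q j) : D P ⌊2 ^ P * t⌋₊ := by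
  induction P, hq using Nat.le_induction with
  | base => rwa [(mem_cell_iff.1 ht).2]
  | succ m _ ih => exact hD _ _ (by rwa [floor_pow_succ_div_two])

/-- Split a clean cell into children by `hf` while both stay clean. At the first dirty child, `hc`
for the clean parent is paid for by that child, which is half as long: this is the factor 2. A cell
clean down to generation `P` has `f = 0` unless `X` holds there. -/
theorem le_volume_of_gaps {D : ℕ → ℕ → Prop} (hD : ∀ q j, D q (j / 2) → D (q + 1) j)
    {f : ℕ → ℕ → ℝ≥0∞} (hf : ∀ q j, f q j ≤ f (q + 1) (2 * j) + f (q + 1) (2 * j + 1)) {c : ℝ≥0∞}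
    (hc : ∀ q j, ¬ D q j → f q j ≤ c * ENNReal.ofReal (1 / 2 ^ q)) {P : ℕ} {X : ℕ → Prop}
    (hX : ∀ j, ¬ X j → f P j = 0) {q : ℕ} (hq : q ≤ P) {j : ℕ} (hj : ¬ D q j) :
    f q j ≤ 2 * c * volume (cell q j ∩ {t | D P ⌊2 ^ P * t⌋₊ ∨ X ⌊2 ^ P * t⌋₊}) := by
  obtain ⟨d, rfl⟩ := Nat.exists_eq_add_of_le hq
  clear hq
  induction d generalizing q j with
  | zero =>
    rw [add_zero] at *
    by_cases h : X j
    · have : cell q j ∩ {t | D q ⌊2 ^ q * t⌋₊ ∨ X ⌊2 ^ q * t⌋₊} = cell q j := by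
        refine Set.inter_eq_left.2 fun t ht => Or.inr ?_
        rwa [(mem_cell_iff.1 ht).2]
      rw [this, volume_cell]
      refine (hc q j hj).trans ?_
      rw [mul_assoc, two_mul]
      exact le_self_add
    · rw [hX j h]; exact bot_le
  | succ d ih =>
    set Y := {t : ℝ | D (q + (d + 1)) ⌊2 ^ (q + (d + 1)) * t⌋₊ ∨ X ⌊2 ^ (q + (d + 1)) * t⌋₊} with hY
    have hYm : MeasurableSet Y :=
      measurableSet_floor (q + (d + 1)) fun j => D (q + (d + 1)) j ∨ X j
    have hsplit : volume (cell q j ∩ Y) =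
        volume (cell (q + 1) (2 * j) ∩ Y) + volume (cell (q + 1) (2 * j + 1) ∩ Y) := by
      rw [cell_eq_union, Set.union_inter_distrib_right, measure_union _
        ((measurableSet_cell _ _).inter hYm)]
      exact (disjoint_cell (by omega)).mono Set.inter_subset_left Set.inter_subset_left
    have hfull : ∀ i, D (q + 1) i → volume (cell (q + 1) i ∩ Y) = ENNReal.ofReal (1 / 2 ^ (q + 1)) := by
      intro i hi
      rw [← volume_cell (q + 1) i, Set.inter_eq_left.2]
      intro t ht
      exact Or.inl (cell_subset_of_mono hD (by omega) hi ht)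
    have hhalf : c * ENNReal.ofReal (1 / 2 ^ q) = 2 * c * ENNReal.ofReal (1 / 2 ^ (q + 1)) := by
      rw [mul_comm 2 c, mul_assoc]
      congr 1
      rw [← ENNReal.ofReal_ofNat 2, ← ENNReal.ofReal_mul (by norm_num)]
      congr 1
      rw [pow_succ]; field_simp
    have ih' : ∀ i, ¬ D (q + 1) i → f (q + 1) i ≤ 2 * c * volume (cell (q + 1) i ∩ Y) := by
      intro i hi
      have e : q + (d + 1) = q + 1 + d := by omega
      have := ih (q := q + 1) (j := i) hi (by rwa [← e])
      rwa [← e] at this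
    rw [hsplit, mul_add]
    by_cases h0 : D (q + 1) (2 * j)
    · refine (hc q j hj).trans ?_
      rw [hhalf, hfull _ h0]
      exact le_self_add
    by_cases h1 : D (q + 1) (2 * j + 1)
    · refine (hc q j hj).trans ?_
      rw [hhalf, hfull _ h1]
      exact le_add_self
    exact (hf q j).trans (add_le_add (ih' _ h0) (ih' _ h1))

open Classical in
theorem sum_cell_le {q : ℕ} {B : ℕ → Prop} {Y : Set ℝ} (hY : MeasurableSet Y) {A : ℝ≥0∞}
    (h : ∀ j, B j → ENNReal.ofReal (1 / 2 ^ q) ≤ A * volume (cell q j ∩ Y)) :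
    ∑ j ∈ Finset.range (2 ^ q), (if B j then ENNReal.ofReal (1 / 2 ^ q) else 0) ≤
      A * volume (Set.Ico 0 1 ∩ Y) := by
  calc _ ≤ ∑ j ∈ Finset.range (2 ^ q), A * volume (cell q j ∩ Y) := by
        refine Finset.sum_le_sum fun j _ => ?_
        split_ifs with hj
        · exact h j hj
        · exact bot_le
    _ = A * volume (⋃ j ∈ Finset.range (2 ^ q), cell q j ∩ Y) := by
        rw [← Finset.mul_sum, measure_biUnion_finset]
        · intro i _ j _ hij
          exact (disjoint_cell hij).mono Set.inter_subset_left Set.inter_subset_left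
        · exact fun j _ => (measurableSet_cell _ _).inter hY
    _ ≤ _ := by
        gcongr
        refine Set.iUnion₂_subset fun j hj => ?_
        exact Set.inter_subset_inter_left _ (cell_subset_Ico (Finset.mem_range.1 hj))

theorem dyad_subset_union (q j : ℕ) : dyad q j ⊆ dyad (q + 1) (2 * j) ∪ dyad (q + 1) (2 * j + 1) := by
  intro t ht
  have h2 : (0 : ℝ) < 2 ^ q := by positivity
  have h3 : (0 : ℝ) < 2 ^ (q + 1) := by positivity
  have h4 : (2 : ℝ) ^ (q + 1) = 2 * 2 ^ q := by ring
  simp only [dyad, Set.mem_union, Set.mem_Icc, div_le_iff₀ h2, le_div_iff₀ h2, div_le_iff₀ h3,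
    le_div_iff₀ h3] at ht ⊢
  rw [h4]
  push_cast
  rcases le_total (t * (2 * 2 ^ q)) (2 * (j : ℝ) + 1) with h | h
  · left; constructor <;> linarith [ht.1]
  · right; constructor <;> linarith [ht.2]

theorem cone_subset_union (q j : ℕ) (x : Plane) :
    cone q j x ⊆ cone (q + 1) (2 * j) x ∪ cone (q + 1) (2 * j + 1) x := by
  rintro y ⟨t, ht, h⟩
  rcases dyad_subset_union q j ht with hs | hs
  · exact Or.inl ⟨t, hs, h⟩
  · exact Or.inr ⟨t, hs, h⟩

/-! ### Bad cells, and what they force at finer generations. -/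

/-- The closed annulus around `x`. -/
def annulus (a b : ℝ) (x : Plane) : Set Plane := {y | a ≤ dist y x ∧ dist y x ≤ b}

/-- A dyadic interval which is not dirty, but whose cone in the annulus carries mass. -/
def Bad (μ : Measure Plane) (K lam : ℝ≥0∞) (a b : ℝ) (q j : ℕ) (x : Plane) : Prop :=
  ¬ Dirty μ K x q j ∧ ∃ r : ℚ, 0 < r ∧ lam * ENNReal.ofReal (r / 2 ^ q) <
    μ (cone q j x ∩ annulus a b x ∩ Metric.closedBall x r)

/-- The dyadic interval of directions at `x` meets `E` in the annulus. -/
def Hits (E : Set Plane) (a b : ℝ) (q j : ℕ) (x : Plane) : Prop :=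
  ∃ y ∈ E, y ∈ cone q j x ∧ y ∈ annulus a b x

/-- `le_volume_of_gaps` applies to the cone mass in the annulus up to the radius `r` witnessing
badness, and `r` cancels. The cell is clean at generation `q`, hence at the coarser `p`, so dirt
found at `P` is new since `p`. -/
theorem volume_cell_le_of_bad {μ : Measure Plane} {K lam : ℝ≥0∞} {E : Set Plane} (hμ : μ Eᶜ = 0)
    {a b : ℝ} {p q P : ℕ} (hp : p ≤ q) (hq : q ≤ P) {j : ℕ} {x : Plane}
    (hbad : Bad μ K lam a b q j x) :
    lam * ENNReal.ofReal (1 / 2 ^ q) ≤ 2 * K * volume (cell q j ∩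
      {t | (Dirty μ K x P ⌊2 ^ P * t⌋₊ ∧ ¬ Dirty μ K x p ⌊2 ^ p * t⌋₊) ∨
        (Hits E a b P ⌊2 ^ P * t⌋₊ x ∧ ¬ Dirty μ K x P ⌊2 ^ P * t⌋₊)}) := by
  obtain ⟨hclean, r, hr, hmass⟩ := hbad
  have hr' : (0 : ℝ) < r := Rat.cast_pos.2 hr
  have key := le_volume_of_gaps (D := Dirty μ K x) (fun q j h => Or.inl h)
    (f := fun q j => μ (cone q j x ∩ annulus a b x ∩ Metric.closedBall x r))
    (c := K * ENNReal.ofReal r) (P := P) (X := fun j => Hits E a b P j x)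
    (fun q j => ?_) (fun q j h => ?_) (fun j h => ?_) hq hclean
  · have hsub : cell q j ∩ {t | Dirty μ K x P ⌊2 ^ P * t⌋₊ ∨ Hits E a b P ⌊2 ^ P * t⌋₊ x} ⊆
        cell q j ∩ {t | (Dirty μ K x P ⌊2 ^ P * t⌋₊ ∧ ¬ Dirty μ K x p ⌊2 ^ p * t⌋₊) ∨
        (Hits E a b P ⌊2 ^ P * t⌋₊ x ∧ ¬ Dirty μ K x P ⌊2 ^ P * t⌋₊)} := by
      rintro t ⟨ht, h⟩
      refine ⟨ht, ?_⟩
      have hnp : ¬ Dirty μ K x p ⌊2 ^ p * t⌋₊ := by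
        intro h'
        have := dirty_mono hp h'
        rw [(mem_cell_iff.1 ht).2] at this
        exact hclean this
      by_cases hd : Dirty μ K x P ⌊2 ^ P * t⌋₊
      · exact Or.inl ⟨hd, hnp⟩
      · exact Or.inr ⟨h.resolve_left hd, hd⟩
    have h1 := hmass.le.trans (key.trans (mul_le_mul_right (measure_mono hsub) _))
    have hr0 : ENNReal.ofReal r ≠ 0 := by simp [hr]
    have e1 : lam * ENNReal.ofReal (r / 2 ^ q) =
        ENNReal.ofReal r * (lam * ENNReal.ofReal (1 / 2 ^ q)) := by
      rw [div_eq_mul_one_div, ENNReal.ofReal_mul hr'.le]; ring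
    refine (ENNReal.mul_le_mul_iff_right hr0 ENNReal.ofReal_ne_top).1 ?_
    rw [← e1]
    refine h1.trans (le_of_eq ?_)
    ring
  · refine (measure_mono ?_).trans (measure_union_le _ _)
    rintro y ⟨⟨hy, h1⟩, h2⟩
    rcases cone_subset_union q j x hy with h | h
    · exact Or.inl ⟨⟨h, h1⟩, h2⟩
    · exact Or.inr ⟨⟨h, h1⟩, h2⟩
  · have hnd : ¬ HighDensity μ K x q j := by
      cases q with
      | zero => exact h
      | succ q => exact fun h' => h (Or.inr h')
    simp only [HighDensity, not_or, not_exists, not_and, not_lt] at hnd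
    refine (measure_mono ?_).trans ((hnd.1 r hr).trans (le_of_eq ?_))
    · exact fun y hy => ⟨hy.1.1, hy.2⟩
    · rw [div_eq_mul_one_div, ENNReal.ofReal_mul hr'.le]; ring
  · refine measure_mono_null ?_ hμ
    intro y hy hyE
    exact h ⟨y, hyE, hy.1.1, hy.1.2⟩

/-! ### Measurability, and counting of hits. -/

/-- Projection along a compact factor is a closed map; taking the dyadic intervals of directions
closed makes this available for cones and strips. -/
theorem isClosed_exists_mem {X Y : Type*} [TopologicalSpace X] [TopologicalSpace Y] {K : Set Y}
    (hK : IsCompact K) {S : Set (X × Y)} (hS : IsClosed S) : IsClosed {x | ∃ y ∈ K, (x, y) ∈ S} := by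
  have : CompactSpace K := isCompact_iff_compactSpace.1 hK
  have h1 : IsClosed ((fun p : X × K => (p.1, (p.2 : Y))) ⁻¹' S) := hS.preimage (by fun_prop)
  convert isClosedMap_fst_of_compactSpace _ h1
  ext x
  simp

theorem isCompact_dyad (q j : ℕ) : IsCompact (dyad q j) := isCompact_Icc

theorem isClosed_cone_pairs (q j : ℕ) : IsClosed {p : Plane × Plane | p.2 ∈ cone q j p.1} := by
  have : IsClosed {z : (Plane × Plane) × ℝ | pr (z.1.2 - z.1.1) z.2 = 0} :=
    isClosed_eq (by unfold pr; fun_prop) continuous_const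
  exact isClosed_exists_mem (isCompact_dyad q j) this

theorem isClosed_strip_pairs (q j : ℕ) : IsClosed {p : Plane × Plane | p.2 ∈ strip q j p.1} := by
  have : IsClosed {z : (Plane × Plane) × ℝ | |pr (z.1.2 - z.1.1) z.2| ≤ 1 / 2 ^ q} :=
    isClosed_le (by unfold pr; fun_prop) continuous_const
  exact isClosed_exists_mem (isCompact_dyad q j) this

theorem isClosed_annulus_pairs (a b : ℝ) : IsClosed {p : Plane × Plane | p.2 ∈ annulus a b p.1} :=
  (isClosed_le (f := fun _ : Plane × Plane => a) (g := fun p => dist p.2 p.1) (by fun_prop)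
    (by fun_prop)).inter (isClosed_le (f := fun p : Plane × Plane => dist p.2 p.1) (g := fun _ => b)
    (by fun_prop) (by fun_prop))

theorem isClosed_closedBall_pairs (r : ℝ) :
    IsClosed {p : Plane × Plane | p.2 ∈ Metric.closedBall p.1 r} :=
  isClosed_le (f := fun p : Plane × Plane => dist p.2 p.1) (g := fun _ => r) (by fun_prop)
    (by fun_prop)

theorem measurableSet_lt_measure (μ : Measure Plane) [IsFiniteMeasure μ] {S : Set (Plane × Plane)}
    (hS : IsClosed S) (c : ℝ≥0∞) : MeasurableSet {x | c < μ {y | (x, y) ∈ S}} :=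
  measurableSet_lt measurable_const (measurable_measure_prodMk_left hS.measurableSet)

/-- Radii are rational in the density conditions so that this union is countable. -/
theorem measurableSet_exists_rat {X : Type*} [MeasurableSpace X] {p : ℚ → X → Prop}
    (h : ∀ r, MeasurableSet {x | p r x}) : MeasurableSet {x | ∃ r : ℚ, 0 < r ∧ p r x} := by
  have : {x | ∃ r : ℚ, 0 < r ∧ p r x} = ⋃ r : ℚ, ⋃ (_ : 0 < r), {x | p r x} := by ext; simp
  rw [this]
  exact MeasurableSet.iUnion fun r => MeasurableSet.iUnion fun _ => h r

theorem measurableSet_highDensity (μ : Measure Plane) [IsFiniteMeasure μ] (K : ℝ≥0∞) (q j : ℕ) :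
    MeasurableSet {x | HighDensity μ K x q j} := by
  refine MeasurableSet.union (measurableSet_exists_rat fun r => ?_) ?_
  · exact measurableSet_lt_measure μ ((isClosed_cone_pairs q j).inter (isClosed_closedBall_pairs r)) _
  · exact measurableSet_lt_measure μ (isClosed_strip_pairs q j) _

theorem measurableSet_dirty (μ : Measure Plane) [IsFiniteMeasure μ] (K : ℝ≥0∞) (q j : ℕ) :
    MeasurableSet {x | Dirty μ K x q j} := by
  induction q generalizing j with
  | zero => exact measurableSet_highDensity μ K 0 j
  | succ q ih => exact (ih (j / 2)).union (measurableSet_highDensity μ K (q + 1) j)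

theorem measurableSet_bad (μ : Measure Plane) [IsFiniteMeasure μ] (K lam : ℝ≥0∞) (a b : ℝ)
    (q j : ℕ) : MeasurableSet {x | Bad μ K lam a b q j x} := by
  refine (measurableSet_dirty μ K q j).compl.inter (measurableSet_exists_rat fun r => ?_)
  exact measurableSet_lt_measure μ (((isClosed_cone_pairs q j).inter
    (isClosed_annulus_pairs a b)).inter (isClosed_closedBall_pairs r)) _

theorem isClosed_hits {E : Set Plane} (hE : IsCompact E) (a b : ℝ) (q j : ℕ) :
    IsClosed {x | Hits E a b q j x} :=
  isClosed_exists_mem hE ((isClosed_cone_pairs q j).inter (isClosed_annulus_pairs a b))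

theorem measurableSet_pairs {R : ℕ → Plane → Prop} (h : ∀ j, MeasurableSet {x | R j x}) (q : ℕ) :
    MeasurableSet {p : Plane × ℝ | R ⌊2 ^ q * p.2⌋₊ p.1} := by
  have : {p : Plane × ℝ | R ⌊2 ^ q * p.2⌋₊ p.1} =
      ⋃ j : ℕ, {x | R j x} ×ˢ {t : ℝ | ⌊2 ^ q * t⌋₊ = j} := by
    ext p; simp
  rw [this]
  exact MeasurableSet.iUnion fun j => (h j).prod (measurableSet_floor q fun i => i = j)

theorem measurableSet_dirtySet (μ : Measure Plane) [IsFiniteMeasure μ] (K : ℝ≥0∞) (q : ℕ) :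
    MeasurableSet (dirtySet μ K q) :=
  measurableSet_pairs (R := fun j x => Dirty μ K x q j) (measurableSet_dirty μ K q) q

/-- The pairs whose direction meets `E` in the annulus, at generation `P`. -/
def hitSet (E : Set Plane) (a b : ℝ) (P : ℕ) : Set (Plane × ℝ) :=
  {p | Hits E a b P ⌊2 ^ P * p.2⌋₊ p.1}

theorem measurableSet_hitSet {E : Set Plane} (hE : IsCompact E) (a b : ℝ) (P : ℕ) :
    MeasurableSet (hitSet E a b P) :=
  measurableSet_pairs (R := fun j x => Hits E a b P j x)
    (fun j => (isClosed_hits hE a b P j).measurableSet) P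

open Classical in
/-- The pairs whose direction meets `E` in at least `k` of the annuli with index in `I`. -/
def multSet (E : Set Plane) (a b : ℕ → ℝ) (I : Finset ℕ) (k P : ℕ) : Set (Plane × ℝ) :=
  {p | k ≤ (I.filter fun n => p ∈ hitSet E (a n) (b n) P).card}

open Classical in
theorem measurable_card_filter {X ι : Type*} [MeasurableSpace X] {S : ι → Set X}
    (hS : ∀ i, MeasurableSet (S i)) (I : Finset ι) :
    Measurable fun x => (I.filter fun n => x ∈ S n).card := by
  have : (fun x => (I.filter fun n => x ∈ S n).card) =
      fun x => ∑ i ∈ I, (S i).indicator (fun _ => 1) x := by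
    ext x
    rw [Finset.card_filter]
    exact Finset.sum_congr rfl fun i _ => by rw [Set.indicator_apply]
  rw [this]
  exact Finset.measurable_sum _ fun i _ => measurable_const.indicator (hS i)

theorem measurableSet_multSet {E : Set Plane} (hE : IsCompact E) (a b : ℕ → ℝ) (I : Finset ℕ)
    (k P : ℕ) : MeasurableSet (multSet E a b I k P) :=
  (measurable_card_filter (fun n => measurableSet_hitSet hE (a n) (b n) P) I)
    (MeasurableSet.of_discrete (s := {m | k ≤ m}))

open Classical in
theorem mul_measure_card_filter_le {X ι : Type*} [MeasurableSpace X] (ν : Measure X) {S : ι → Set X}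
    (hS : ∀ i, MeasurableSet (S i)) (I : Finset ι) (k : ℕ) :
    k * ν {x | k ≤ (I.filter fun n => x ∈ S n).card} ≤ ∑ i ∈ I, ν (S i) := by
  have hm : Measurable fun x => (((I.filter fun n => x ∈ S n).card : ℕ) : ℝ≥0∞) :=
    (measurable_from_nat (f := fun n : ℕ => (n : ℝ≥0∞))).comp (measurable_card_filter hS I)
  have h := mul_meas_ge_le_lintegral (μ := ν) hm k
  calc _ ≤ _ := by simpa using h
    _ = ∫⁻ x, ∑ i ∈ I, (S i).indicator (fun _ => (1 : ℝ≥0∞)) x ∂ν := by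
        refine lintegral_congr fun x => ?_
        rw [Finset.card_filter, Nat.cast_sum]
        exact Finset.sum_congr rfl fun i _ => by rw [Set.indicator_apply]; push_cast; rfl
    _ = _ := by
        rw [lintegral_finsetSum _ fun i _ => measurable_const.indicator (hS i)]
        refine Finset.sum_congr rfl fun i _ => ?_
        rw [lintegral_indicator (hS i)]; simp

/-! ### Clean hits of high multiplicity. -/

/-- A set of clean points whose `2^{-P}`-neighbourhoods project into `Q` has mass at most
`K` times the length of `Q`. -/
theorem measure_le_of_not_dirty {μ : Measure Plane} {K : ℝ≥0∞} {P j : ℕ} {t : ℝ}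
    (ht : t ∈ dyad P j) {A : Set Plane} (hA : ∀ x ∈ A, ¬ Dirty μ K x P j) {Q : Set ℝ}
    (hQ : ∀ x ∈ A, ∀ c, |c - pr x t| ≤ 1 / 2 ^ P → c ∈ Q) : μ A ≤ K * volume Q := by
  -- Cut the line into intervals of length `1/2^P`. The points of `A` over one interval lie in the
  -- strip of any one of them, and an interval containing such a projection lies in `Q`.
  set s : ℝ := 1 / 2 ^ P with hs
  have hs0 : 0 < s := by positivity
  set g : ℤ → Set ℝ := fun i => {c | ⌊c / s⌋ = i} with hg
  have hgv : ∀ i, g i = Set.Ico (i * s) ((i + 1) * s) := by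
    intro i
    ext c
    rw [hg, Set.mem_ofPred_eq, Int.floor_eq_iff, le_div_iff₀ hs0, div_lt_iff₀ hs0, Set.mem_Ico]
  have hclose : ∀ i, ∀ c ∈ g i, ∀ d ∈ g i, |c - d| ≤ s := by
    intro i c hc d hd
    rw [hgv] at hc hd
    rw [abs_le]
    constructor <;> linarith [hc.1, hc.2, hd.1, hd.2]
  set Z : Set ℤ := {i | ∃ x ∈ A, pr x t ∈ g i} with hZ
  have hZc : Z.Countable := Set.to_countable Z
  calc μ A ≤ μ (⋃ i ∈ Z, {x | x ∈ A ∧ pr x t ∈ g i}) := by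
        refine measure_mono fun x hx => ?_
        exact Set.mem_biUnion (x := ⌊pr x t / s⌋) ⟨x, hx, rfl⟩ ⟨hx, rfl⟩
    _ ≤ ∑' i : Z, μ {x | x ∈ A ∧ pr x t ∈ g i} := measure_biUnion_le _ hZc _
    _ ≤ ∑' i : Z, K * volume (g i) := by
        refine ENNReal.tsum_le_tsum fun ⟨i, x, hx, hxi⟩ => ?_
        have h1 := not_highDensity_of_not_dirty (hA x hx)
        rw [HighDensity, not_or, not_lt] at h1
        have hv : volume (g i) = ENNReal.ofReal s := by
          rw [hgv, Real.volume_Ico, ← sub_mul, add_sub_cancel_left, one_mul]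
        rw [hv]
        refine le_trans (measure_mono ?_) h1.2
        rintro y ⟨-, hy⟩
        refine ⟨t, ht, ?_⟩
        rw [pr_sub]
        exact hclose i _ hy _ hxi
    _ = K * volume (⋃ i ∈ Z, g i) := by
        rw [ENNReal.tsum_mul_left, measure_biUnion hZc]
        · intro i _ j _ hij
          refine Set.disjoint_left.2 fun c hc hd => hij (hc.symm.trans hd)
        · intro i _; rw [hgv]; exact measurableSet_Ico
    _ ≤ _ := by
        gcongr
        refine Set.iUnion₂_subset fun i ⟨x, hx, hxi⟩ c hc => ?_
        exact hQ x hx c (hclose i c hc _ hxi)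

-- Distinct annuli are separated by at least `2v`, so hits in them lie in distinct covering balls,
-- all projecting near `x`. A clean point of multiplicity `k` thus lies over offsets covered `k`
-- times by doubled projected balls. Markov's inequality bounds their length, and
-- `measure_le_of_not_dirty` converts length into mass.
open Classical in
theorem measure_multSet_slice_le {μ : Measure Plane} {K Λ : ℝ≥0∞} {E : Set Plane} {a b : ℕ → ℝ}
    {I : Finset ℕ} {k P : ℕ} {u v : ℝ} {F : Finset (Plane × ℝ)}
    (hF : ∀ B ∈ F, u ≤ B.2 ∧ B.2 ≤ v) (hcov : E ⊆ ⋃ B ∈ F, Metric.ball B.1 B.2)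
    (hsum : ∑ B ∈ F, ENNReal.ofReal B.2 ≤ Λ) (hP : 15 * (1 / 2 ^ P) ≤ u)
    (hb : ∀ n ∈ I, b n ≤ 2) (hsep : ∀ n ∈ I, ∀ m ∈ I, n < m → 2 * v + b m ≤ a n) {t : ℝ}
    (ht : 0 ≤ t) :
    k * μ {x | x ∈ E ∧ (x, t) ∈ multSet E a b I k P \ dirtySet μ K P} ≤ 4 * (K * Λ) := by
  set S : Plane × ℝ → Set ℝ := fun B => Metric.closedBall (pr B.1 t) (2 * B.2) with hS
  have hSm : ∀ B, MeasurableSet (S B) := fun B => Metric.isClosed_closedBall.measurableSet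
  set Q : Set ℝ := {c | k ≤ (F.filter fun B => c ∈ S B).card} with hQ
  have htd := mem_dyad_floor P ht
  have h1 : μ {x | x ∈ E ∧ (x, t) ∈ multSet E a b I k P \ dirtySet μ K P} ≤ K * volume Q := by
    refine measure_le_of_not_dirty htd (fun x hx => hx.2.2) fun x hx c hc => ?_
    rw [hQ, Set.mem_ofPred_eq]
    refine le_trans hx.2.1 ?_
    have hchoose : ∀ n ∈ I.filter fun n => (x, t) ∈ hitSet E (a n) (b n) P,
        ∃ B ∈ F, ∃ y, y ∈ annulus (a n) (b n) x ∧ y ∈ cone P ⌊2 ^ P * t⌋₊ x ∧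
          y ∈ Metric.ball B.1 B.2 := by
      intro n hn
      obtain ⟨y, hyE, hy1, hy2⟩ := (Finset.mem_filter.1 hn).2
      obtain ⟨B, hB, hyB⟩ := Set.mem_iUnion₂.1 (hcov hyE)
      exact ⟨B, hB, y, hy2, hy1, hyB⟩
    choose! f hfF y hya hyc hyb using hchoose
    refine Finset.card_le_card_of_injOn f (fun n hn => ?_) ?_
    · rw [Finset.mem_coe] at hn
      rw [Finset.mem_coe, Finset.mem_filter]
      refine ⟨hfF n hn, ?_⟩
      rw [hS, Metric.mem_closedBall, Real.dist_eq]
      -- The errors are `1/2^P` from `c`, `14/2^P` from the cone at distance at most 2, and one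
      -- radius from the ball; `hP` bounds the first two by a second radius.
      have e1 := abs_pr_le_of_mem_cone htd (hyc n hn)
      rw [pr_sub] at e1
      have e2 := abs_pr_sub_pr_le (y n) (f n).1 t
      have e3 := hyb n hn
      rw [Metric.mem_ball] at e3
      have e4 : dist (y n) x ≤ 2 := (hya n hn).2.trans (hb n (Finset.mem_filter.1 hn).1)
      have e5 : 7 * (1 / 2 ^ P) * dist (y n) x ≤ 7 * (1 / 2 ^ P) * 2 := by gcongr
      have e6 := (hF _ (hfF n hn)).1
      rw [abs_le] at *
      constructor <;> linarith [e1.1, e1.2, e2.1, e2.2, hc.1, hc.2]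
    · have hne : ∀ n ∈ I.filter (fun n => (x, t) ∈ hitSet E (a n) (b n) P),
          ∀ m ∈ I.filter (fun n => (x, t) ∈ hitSet E (a n) (b n) P), n < m → f n ≠ f m := by
        intro n hn m hm hnm he
        have e1 := hyb n hn
        have e2 := hyb m hm
        rw [← he] at e2
        rw [Metric.mem_ball] at e1 e2
        have e3 := hsep n (Finset.mem_filter.1 hn).1 m (Finset.mem_filter.1 hm).1 hnm
        have e4 := (hya n hn).1
        have e5 := (hya m hm).2
        have e6 := (hF _ (hfF n hn)).2
        have e7 := dist_triangle (y n) (y m) x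
        have e8 := dist_triangle_right (y n) (y m) (f n).1
        linarith
      intro n hn m hm he
      by_contra h
      rcases lt_or_gt_of_ne h with h | h
      · exact hne n hn m hm h he
      · exact hne m hm n hn h he.symm
  have h2 := mul_measure_card_filter_le volume hSm F k
  have h3 : ∑ B ∈ F, volume (S B) ≤ 4 * Λ := by
    calc ∑ B ∈ F, volume (S B) = ∑ B ∈ F, 4 * ENNReal.ofReal B.2 := by
          refine Finset.sum_congr rfl fun B _ => ?_
          rw [hS, Real.volume_closedBall, ← mul_assoc, ENNReal.ofReal_mul (by norm_num)]
          norm_num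
      _ = 4 * ∑ B ∈ F, ENNReal.ofReal B.2 := by rw [Finset.mul_sum]
      _ ≤ _ := by gcongr
  calc _ ≤ k * (K * volume Q) := by gcongr
    _ = K * (k * volume Q) := by ring
    _ ≤ K * (4 * Λ) := mul_le_mul_right (h2.trans h3) K
    _ = _ := by ring

theorem measure_multSet_diff_le {μ : Measure Plane} [IsFiniteMeasure μ] {K Λ : ℝ≥0∞}
    {E : Set Plane} (hE : IsCompact E) (hμ : μ Eᶜ = 0) {a b : ℕ → ℝ}
    {I : Finset ℕ} {k P : ℕ} {u v : ℝ} {F : Finset (Plane × ℝ)}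
    (hF : ∀ B ∈ F, u ≤ B.2 ∧ B.2 ≤ v) (hcov : E ⊆ ⋃ B ∈ F, Metric.ball B.1 B.2)
    (hsum : ∑ B ∈ F, ENNReal.ofReal B.2 ≤ Λ) (hP : 15 * (1 / 2 ^ P) ≤ u)
    (hb : ∀ n ∈ I, b n ≤ 2) (hsep : ∀ n ∈ I, ∀ m ∈ I, n < m → 2 * v + b m ≤ a n) :
    k * (μ.prod (volume.restrict (Set.Ico (0 : ℝ) 1))) (multSet E a b I k P \ dirtySet μ K P) ≤
      4 * (K * Λ) := by
  have hm : MeasurableSet (multSet E a b I k P \ dirtySet μ K P) :=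
    (measurableSet_multSet hE a b I k P).diff (measurableSet_dirtySet μ K P)
  rw [Measure.prod_apply_symm hm, ← lintegral_const_mul' _ _ (by simp)]
  calc _ ≤ ∫⁻ t in Set.Ico (0 : ℝ) 1, 4 * (K * Λ) := by
        refine setLIntegral_mono' measurableSet_Ico fun t ht => ?_
        refine le_trans ?_ (measure_multSet_slice_le (k := k) (μ := μ) (K := K) hF hcov hsum hP hb
          hsep ht.1)
        refine mul_le_mul_right ?_ _
        rw [← measure_inter_conull hμ]
        exact measure_mono fun x hx => ⟨hx.2, hx.1⟩
    _ = _ := by simp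

/-! ### Clean points inside one ball. -/

/-- A set of points that is Lipschitz over its projection up to an error `e` projects to a set whose
length is controlled by the rectifiability constant. -/
theorem volume_pr_image_le_rectConst {E G : Set Plane} {e u ρ : ℝ} {δ : ℝ≥0∞} (hu : 0 < u)
    (huρ : u ≤ ρ) (hR : rectConst E e u (1 / u) ≤ δ) (hGE : G ⊆ E)
    (hE : E ⊆ Metric.closedBall 0 1) {z : Plane} (hGz : G ⊆ Metric.ball z ρ) {t : ℝ}
    (hG : ∀ x ∈ G, ∀ y ∈ G, |prp x t - prp y t| ≤ 1 / u * |pr x t - pr y t| + e) :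
    volume ((fun x => pr x t) '' G) ≤ δ * ENNReal.ofReal (2 * ρ) := by
  rcases G.eq_empty_or_nonempty with rfl | hne
  · simp
  have : Nonempty G := hne.to_subtype
  set M : ℝ := 1 / u with hM
  have hM0 : 0 < M := by positivity
  -- McShane's lower envelope: it is `M`-Lipschitz, and over a point of `G` it lies below that point
  -- by at most `e`.
  set F : ℝ → ℝ := fun s => ⨅ y : G, (prp y t + M * |s - pr y t|) with hF
  have hbdd : ∀ s, BddBelow (Set.range fun y : G => prp (y : Plane) t + M * |s - pr y t|) := by
    intro s
    refine ⟨-1, ?_⟩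
    rintro _ ⟨y, rfl⟩
    have h1 := abs_prp_le (y : Plane) t
    have h2 := hE (hGE y.2)
    rw [mem_closedBall_zero_iff] at h2
    have h3 := (abs_le.1 (h1.trans h2)).1
    have : 0 ≤ M * |s - pr y t| := by positivity
    simp only
    linarith
  have hFle : ∀ s s', F s ≤ F s' + M * |s - s'| := by
    intro s s'
    rw [← sub_le_iff_le_add]
    refine le_ciInf fun y => ?_
    rw [sub_le_iff_le_add]
    refine (ciInf_le (hbdd s) y).trans ?_
    have : |s - pr y t| ≤ |s' - pr y t| + |s - s'| := by
      have := abs_sub_le s s' (pr y t); linarith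
    nlinarith
  have hLip : ∀ s s', |F s - F s'| ≤ M * |s - s'| := by
    intro s s'
    rw [abs_sub_le_iff]
    have := hFle s s'
    have := hFle s' s
    rw [abs_sub_comm s' s] at this
    constructor <;> linarith
  have hρ : 0 < ρ := hu.trans_le huρ
  have hnear : (fun x => pr x t) '' G ⊆
      nearGraph E e (dir t) (perp t) F (Set.Icc (pr z t - ρ) (pr z t + ρ)) := by
    rintro _ ⟨x, hx, rfl⟩
    have hxz := abs_pr_sub_pr_le x z t
    have hxz' := hGz hx
    rw [Metric.mem_ball] at hxz'
    have hd := abs_le.1 (hxz.trans hxz'.le)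
    refine ⟨⟨by linarith, by linarith⟩, prp x t - F (pr x t), ?_, ?_, ?_⟩
    · have h1 : F (pr x t) ≤ prp x t := by
        have := ciInf_le (hbdd (pr x t)) ⟨x, hx⟩
        simpa using this
      have he : 0 ≤ e := by simpa using hG x hx x hx
      linarith
    · have h1 : prp x t - e ≤ F (pr x t) := by
        refine le_ciInf fun y => ?_
        have := (abs_le.1 (hG x hx y y.2)).2
        linarith
      linarith
    · simp only
      rw [add_sub_cancel, pr_smul_add_prp_smul]
      exact hGE hx
  have hvol : volume (Set.Icc (pr z t - ρ) (pr z t + ρ)) = ENNReal.ofReal (2 * ρ) := by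
    rw [Real.volume_Icc]; congr 1; ring
  have hR' : volume (nearGraph E e (dir t) (perp t) F (Set.Icc (pr z t - ρ) (pr z t + ρ))) /
      volume (Set.Icc (pr z t - ρ) (pr z t + ρ)) ≤ δ := by
    refine le_trans ?_ hR
    unfold rectConst
    refine le_iSup_of_le (dir t) (le_iSup_of_le (perp t) (le_iSup_of_le
      ⟨norm_dir t, norm_perp t, inner_dir_perp t⟩ (le_iSup_of_le F (le_iSup_of_le hLip
      (le_iSup_of_le (pr z t - ρ) (le_iSup_of_le (pr z t + ρ) (le_iSup_of_le ?_ le_rfl)))))))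
    linarith
  rw [hvol] at hR'
  refine (measure_mono hnear).trans ?_
  exact (ENNReal.div_le_iff (by simp [hρ]) ENNReal.ofReal_ne_top).1 hR'

theorem mem_cone_of_abs_pr_le {q j : ℕ} {t τ : ℝ} (h0 : 0 ≤ τ) (h1 : τ ≤ 1 / 4)
    (hI : Set.Icc (t - τ) (t + τ) ⊆ dyad q j) {x y : Plane} (h : |pr (y - x) t| ≤ τ * dist y x) :
    y ∈ cone q j x := by
  rw [dist_eq_norm] at h
  obtain ⟨s, hs, hs0⟩ := exists_pr_eq_zero _ h0 h1 h
  exact ⟨s, hI hs, hs0⟩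

/-- The mass estimate in a strip whose width is governed by the farthest point in the cone. -/
theorem measure_strip_le {μ : Measure Plane} {lam : ℝ≥0∞} {G : Set Plane} {q j : ℕ} {t τ e v : ℝ}
    (h0 : 0 < τ) (h1 : τ ≤ 1 / 4) (hI : Set.Icc (t - τ) (t + τ) ⊆ dyad q j)
    (hdiam : ∀ x ∈ G, ∀ y ∈ G, dist x y ≤ 2 * v)
    (hmass : ∀ x ∈ G, ∀ r : ℚ, 0 < r →
      μ (cone q j x ∩ annulus (e / 4) (2 * v) x ∩ Metric.closedBall x r) ≤
        lam * ENNReal.ofReal (r / 2 ^ q))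
    {x y : Plane} (hx : x ∈ G) (hy : y ∈ G) {h : ℝ} (he : 0 < e) (heh : e ≤ h)
    (hmax : ∀ z ∈ G, e ≤ dist z x → |pr (z - x) t| ≤ τ / 4 * dist z x → dist z x ≤ h)
    (hyh : 3 / 4 * h < dist y x) (hyh' : dist y x ≤ h) (hyc : |pr (y - x) t| ≤ τ / 4 * dist y x) :
    μ {z | z ∈ G ∧ |pr z t - pr x t| ≤ τ * h / 16} ≤ lam * ENNReal.ofReal (3 * h / 2 ^ q) := by
  have hh : 0 < h := he.trans_le heh
  -- Strip points within `h/4` of `x` are within `5h/4` of `y`; two balls of radius below `3h/2`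
  -- give the final `3h`.
  obtain ⟨r, hr1, hr2⟩ := exists_rat_btwn (show 5 / 4 * h < 3 / 2 * h by linarith)
  have hr0 : (0 : ℝ) < r := by linarith
  have hr : 0 < r := Rat.cast_pos.1 hr0
  have hsub : {z | z ∈ G ∧ |pr z t - pr x t| ≤ τ * h / 16} ⊆
      (cone q j x ∩ annulus (e / 4) (2 * v) x ∩ Metric.closedBall x r) ∪
      (cone q j y ∩ annulus (e / 4) (2 * v) y ∩ Metric.closedBall y r) := by
    rintro z ⟨hz, hzs⟩
    rw [← pr_sub] at hzs
    -- The far point `y` is a second apex: `z` is seen from `x` at distance at least `h/4`, or else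
    -- from `y` at distance at least `h/2`. Since `e ≤ h`, both meet the inner radius `e/4`.
    rcases le_or_gt (h / 4) (dist z x) with hd | hd
    · left
      have hc : |pr (z - x) t| ≤ τ / 4 * dist z x := by nlinarith
      have hzh : dist z x ≤ h := by
        by_cases h' : e ≤ dist z x
        · exact hmax z hz h' hc
        · linarith
      refine ⟨⟨mem_cone_of_abs_pr_le h0.le h1 hI ?_, by linarith, hdiam z hz x hx⟩, ?_⟩
      · refine hc.trans ?_
        gcongr
        linarith
      · rw [Metric.mem_closedBall]; linarith
    · right
      have hzy := dist_triangle z y x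
      have hyz := dist_triangle y z x
      have hzy' := dist_triangle_right z y x
      rw [dist_comm y z] at hyz
      refine ⟨⟨mem_cone_of_abs_pr_le h0.le h1 hI ?_, by linarith, hdiam z hz y hy⟩, ?_⟩
      · have e1 : |pr (z - y) t| ≤ |pr (z - x) t| + |pr (y - x) t| := by
          simp only [pr_sub]
          have := abs_sub (pr z t - pr x t) (pr y t - pr x t)
          rwa [sub_sub_sub_cancel_right] at this
        have e2 : τ / 4 * dist y x ≤ τ / 4 * h := by gcongr
        have e3 : τ * (h / 2) ≤ τ * dist z y := by gcongr; linarith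
        have e4 : 0 < τ * h := by positivity
        linarith
      · rw [Metric.mem_closedBall]; linarith
  calc _ ≤ _ := (measure_mono hsub).trans (measure_union_le _ _)
    _ ≤ lam * ENNReal.ofReal (r / 2 ^ q) + lam * ENNReal.ofReal (r / 2 ^ q) :=
        add_le_add (hmass x hx r hr) (hmass y hy r hr)
    _ = lam * ENNReal.ofReal (r / 2 ^ q + r / 2 ^ q) := by
        rw [ENNReal.ofReal_add (by positivity) (by positivity), mul_add]
    _ ≤ _ := by
        gcongr
        rw [← add_div]
        gcongr
        linarith

/-- The points of a clean set that see another point in the cone have small mass. -/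
theorem measure_points_with_cone_le {μ : Measure Plane} {lam : ℝ≥0∞} {G G₁ : Set Plane} {q j D : ℕ}
    (hD : 1 ≤ D) {t τ e v ρ : ℝ} (hτ : τ = 1 / (D * 2 ^ q)) (h1 : τ ≤ 1 / 4)
    (hI : Set.Icc (t - τ) (t + τ) ⊆ dyad q j) {z : Plane} (hGz : G ⊆ Metric.ball z ρ) (hρv : ρ ≤ v)
    (hmass : ∀ x ∈ G, ∀ r : ℚ, 0 < r →
      μ (cone q j x ∩ annulus (e / 4) (2 * v) x ∩ Metric.closedBall x r) ≤
        lam * ENNReal.ofReal (r / 2 ^ q)) (he : 0 < e) (hG₁ : G₁ ⊆ G)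
    (hcone : ∀ x ∈ G₁, ∃ y ∈ G, e ≤ dist y x ∧ |pr (y - x) t| ≤ τ / 4 * dist y x) :
    μ G₁ ≤ 480 * (lam * D) * ENNReal.ofReal ρ := by
  have hD0 : (0 : ℝ) < D := by exact_mod_cast hD
  have h0 : 0 < τ := by rw [hτ]; positivity
  have hdiam : ∀ x ∈ G, ∀ y ∈ G, dist x y ≤ 2 * ρ := by
    intro x hx y hy
    have e1 := hGz hx
    have e2 := hGz hy
    rw [Metric.mem_ball] at e1 e2
    linarith [dist_triangle_right x y z]
  have hfar : ∀ x ∈ G₁, ∃ h : ℝ, e ≤ h ∧ h ≤ 2 * ρ ∧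
      μ {z | z ∈ G ∧ |pr z t - pr x t| ≤ τ * h / 16} ≤ lam * ENNReal.ofReal (3 * h / 2 ^ q) := by
    intro x hx
    set S : Set ℝ := {d | ∃ y ∈ G, e ≤ dist y x ∧ |pr (y - x) t| ≤ τ / 4 * dist y x ∧ dist y x = d}
      with hS
    have hSb : BddAbove S := by
      refine ⟨2 * ρ, ?_⟩
      rintro _ ⟨y, hy, -, -, rfl⟩
      exact hdiam y hy x (hG₁ hx)
    obtain ⟨y₀, hy₀, hey₀, hc₀⟩ := hcone x hx
    have hy₀S : dist y₀ x ∈ S := ⟨y₀, hy₀, hey₀, hc₀, rfl⟩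
    have heh : e ≤ sSup S := hey₀.trans (le_csSup hSb hy₀S)
    -- The supremum need not be attained; a point beyond three quarters of it suffices.
    have hlt : 3 / 4 * sSup S < sSup S := by linarith
    obtain ⟨_, ⟨y, hy, hey, hyc, rfl⟩, hyh⟩ := exists_lt_of_lt_csSup ⟨_, hy₀S⟩ hlt
    refine ⟨sSup S, heh, ?_, ?_⟩
    · refine csSup_le ⟨_, hy₀S⟩ ?_
      rintro _ ⟨y, hy, -, -, rfl⟩
      exact hdiam y hy x (hG₁ hx)
    · refine measure_strip_le h0 h1 hI (fun x hx y hy => (hdiam x hx y hy).trans (by linarith))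
        hmass (hG₁ hx) hy he heh ?_ hyh (le_csSup hSb ⟨y, hy, hey, hyc, rfl⟩) hyc
      intro w hw hew hwc
      exact le_csSup hSb ⟨w, hw, hew, hwc, rfl⟩
  choose! h hh1 hh2 hh3 using hfar
  -- Enlarging radius `τh/80` five times gives exactly the strip half-width `τh/16` of `hfar`.
  obtain ⟨U, hU, hdisj, hcov⟩ := Vitali.exists_disjoint_subfamily_covering_enlargement_closedBall
    G₁ (fun x => pr x t) (fun x => τ * h x / 80) (τ * (2 * ρ) / 80)
    (fun x hx => by have := hh2 x hx; gcongr) 5 (by norm_num)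
  have hhpos : ∀ x ∈ G₁, 0 < h x := fun x hx => he.trans_le (hh1 x hx)
  have hUc : U.Countable := by
    refine hdisj.countable_of_nonempty_interior fun x hx => ?_
    rw [Real.closedBall_eq_Icc, interior_Icc]
    have := hhpos x (hU hx)
    exact Set.nonempty_Ioo.2 (by have : 0 < τ * h x / 80 := by positivity
                                 linarith)
  have hsum : ∑' x : U, volume (Metric.closedBall (pr x t) (τ * h x / 80)) ≤
      ENNReal.ofReal (4 * ρ) := by
    rw [← measure_biUnion hUc hdisj fun x _ => Metric.isClosed_closedBall.measurableSet]
    calc _ ≤ volume (Metric.closedBall (pr z t) (2 * ρ)) := by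
          refine measure_mono (Set.iUnion₂_subset fun x hx => ?_)
          refine Metric.closedBall_subset_closedBall' ?_
          have e1 := abs_pr_sub_pr_le x z t
          have e2 := hGz (hG₁ (hU hx))
          have e3 := hh2 x (hU hx)
          have e4 := hhpos x (hU hx)
          rw [Metric.mem_ball] at e2
          rw [Real.dist_eq]
          nlinarith
      _ = _ := by rw [Real.volume_closedBall]; congr 1; ring
  have hcov' : G₁ ⊆ ⋃ x ∈ U, {w | w ∈ G ∧ |pr w t - pr x t| ≤ τ * h x / 16} := by
    intro w hw
    obtain ⟨x, hx, hsub⟩ := hcov w hw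
    refine Set.mem_biUnion hx ⟨hG₁ hw, ?_⟩
    have hw0 := hhpos w hw
    have := hsub (Metric.mem_closedBall_self (by positivity))
    rw [Metric.mem_closedBall, Real.dist_eq] at this
    refine this.trans (le_of_eq ?_)
    ring
  calc μ G₁ ≤ ∑' x : U, μ {w | w ∈ G ∧ |pr w t - pr x t| ≤ τ * h x / 16} :=
        (measure_mono hcov').trans (measure_biUnion_le _ hUc _)
    _ ≤ ∑' x : U, 120 * (lam * D) * volume (Metric.closedBall (pr x t) (τ * h x / 80)) := by
        refine ENNReal.tsum_le_tsum fun x => (hh3 x (hU x.2)).trans (le_of_eq ?_)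
        have e1 : 3 * h x / 2 ^ q = (120 * D) * (2 * (τ * h x / 80)) := by
          rw [hτ]; field_simp; ring
        rw [Real.volume_closedBall, e1, ENNReal.ofReal_mul (by positivity),
          ENNReal.ofReal_mul (by norm_num), ENNReal.ofReal_natCast]
        simp only [ENNReal.ofReal_ofNat]
        ring
    _ ≤ 120 * (lam * D) * ENNReal.ofReal (4 * ρ) := by
        rw [ENNReal.tsum_mul_left]; gcongr
    _ = _ := by
        rw [ENNReal.ofReal_mul (by norm_num), ENNReal.ofReal_ofNat]
        calc _ = (120 * 4 : ℝ≥0∞) * (lam * D) * ENNReal.ofReal ρ := by ring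
          _ = _ := by norm_num

/-- The projection of a set of clean points inside a ball. -/
theorem volume_pr_image_clean_le {μ : Measure Plane} {lam δ : ℝ≥0∞} {E G : Set Plane} {q j D : ℕ}
    (hD : 1 ≤ D) {t τ e u v ρ : ℝ} (hτ : τ = 1 / (D * 2 ^ q)) (h1 : τ ≤ 1 / 4)
    (hI : Set.Icc (t - τ) (t + τ) ⊆ dyad q j) {z : Plane} (hGz : G ⊆ Metric.ball z ρ) (hρv : ρ ≤ v)
    (hmass : ∀ x ∈ G, ∀ r : ℚ, 0 < r →
      μ (cone q j x ∩ annulus (e / 4) (2 * v) x ∩ Metric.closedBall x r) ≤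
        lam * ENNReal.ofReal (r / 2 ^ q)) (he : 0 < e) (hu : 0 < u) (huρ : u ≤ ρ)
    (huτ : u ≤ τ / 4) (hR : rectConst E e u (1 / u) ≤ δ) (hGE : G ⊆ E)
    (hE : E ⊆ Metric.closedBall 0 1) (hμ : ∀ A ⊆ E, volume ((fun x => pr x t) '' A) ≤ μ A) :
    volume ((fun x => pr x t) '' G) ≤ (2 * δ + 480 * (lam * D)) * ENNReal.ofReal ρ := by
  set G₁ : Set Plane := {x | x ∈ G ∧ ∃ y ∈ G, e ≤ dist y x ∧ |pr (y - x) t| ≤ τ / 4 * dist y x}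
    with hG₁
  have hsub : G₁ ⊆ G := fun x hx => hx.1
  have h2 := (hμ G₁ (hsub.trans hGE)).trans (measure_points_with_cone_le hD hτ h1 hI hGz hρv hmass he hsub
    fun x hx => hx.2)
  -- Two points outside `G₁` at distance at least `e` have projections more than `τ/4 ≥ u` times
  -- that distance apart, so the slope is at most `1/u`; nearer points cost the error `e`.
  have h3 : volume ((fun x => pr x t) '' (G \ G₁)) ≤ δ * ENNReal.ofReal (2 * ρ) := by
    refine volume_pr_image_le_rectConst hu huρ hR (Set.sdiff_subset.trans hGE) hE
      (Set.sdiff_subset.trans hGz) fun x hx y hy => ?_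
    rcases lt_or_ge (dist x y) e with hd | hd
    · have e1 := abs_prp_le (x - y) t
      rw [prp_sub, ← dist_eq_norm] at e1
      have : 0 ≤ 1 / u * |pr x t - pr y t| := by positivity
      linarith
    · have hnc : ¬ |pr (x - y) t| ≤ τ / 4 * dist x y := fun h => hy.2 ⟨hy.1, x, hx.1, hd, h⟩
      rw [not_le] at hnc
      have e1 := abs_prp_le (x - y) t
      rw [prp_sub, ← dist_eq_norm] at e1
      rw [pr_sub] at hnc
      have e2 : u * dist x y ≤ τ / 4 * dist x y := by gcongr
      have e3 : dist x y ≤ 1 / u * |pr x t - pr y t| := by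
        rw [div_mul_eq_mul_div, one_mul, le_div_iff₀ hu]; linarith
      linarith
  calc _ ≤ volume ((fun x => pr x t) '' (G \ G₁)) + volume ((fun x => pr x t) '' G₁) := by
        rw [← Set.sdiff_union_of_subset hsub, Set.image_union, Set.sdiff_union_of_subset hsub]
        exact measure_union_le _ _
    _ ≤ δ * ENNReal.ofReal (2 * ρ) + 480 * (lam * D) * ENNReal.ofReal ρ := add_le_add h3 h2
    _ = _ := by
        rw [ENNReal.ofReal_mul (by norm_num), ENNReal.ofReal_ofNat]; ring

theorem volume_pr_image_le_hausdorff (A : Set Plane) (t : ℝ) :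
    volume ((fun x => pr x t) '' A) ≤ μH[1] A := by
  have h : LipschitzWith 1 fun x : Plane => pr x t := by
    refine LipschitzWith.of_dist_le_mul fun x y => ?_
    rw [Real.dist_eq, NNReal.coe_one, one_mul]
    exact abs_pr_sub_pr_le x y t
  have := h.hausdorffMeasure_image_le (d := 1) zero_le_one A
  simpa [hausdorffMeasure_real] using this

/-! ### The decomposition at one scale. -/

/-- The points of `E` at which the dyadic interval carries little mass in the annulus. -/
def cleanPoints (μ : Measure Plane) (lam : ℝ≥0∞) (a b : ℝ) (q j : ℕ) : Set Plane :=
  {x | ∀ r : ℚ, 0 < r → μ (cone q j x ∩ annulus a b x ∩ Metric.closedBall x r) ≤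
    lam * ENNReal.ofReal (r / 2 ^ q)}

theorem measurableSet_cleanPoints (μ : Measure Plane) [IsFiniteMeasure μ] (lam : ℝ≥0∞) (a b : ℝ)
    (q j : ℕ) : MeasurableSet (cleanPoints μ lam a b q j) := by
  have : cleanPoints μ lam a b q j = {x | ∃ r : ℚ, 0 < r ∧ lam * ENNReal.ofReal (r / 2 ^ q) <
      μ (cone q j x ∩ annulus a b x ∩ Metric.closedBall x r)}ᶜ := by
    ext x; simp [cleanPoints]
  rw [this]
  refine (measurableSet_exists_rat fun r => ?_).compl
  exact measurableSet_lt_measure μ (((isClosed_cone_pairs q j).inter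
    (isClosed_annulus_pairs a b)).inter (isClosed_closedBall_pairs r)) _

/-- The part of a dyadic interval at distance at least `τ` from the end points. -/
def middle (q j : ℕ) (τ : ℝ) : Set ℝ := Set.Icc ((j : ℝ) / 2 ^ q + τ) (((j : ℝ) + 1) / 2 ^ q - τ)

theorem Icc_subset_dyad_of_mem_middle {q j : ℕ} {τ t : ℝ} (ht : t ∈ middle q j τ) :
    Set.Icc (t - τ) (t + τ) ⊆ dyad q j :=
  Set.Icc_subset_Icc (by linarith [ht.1]) (by linarith [ht.2])

theorem volume_middle_le (q j : ℕ) {τ : ℝ} (hτ : 0 ≤ τ) :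
    volume (middle q j τ) ≤ ENNReal.ofReal (1 / 2 ^ q) := by
  rw [middle, Real.volume_Icc]
  refine ENNReal.ofReal_le_ofReal ?_
  have : ((j : ℝ) + 1) / 2 ^ q = (j : ℝ) / 2 ^ q + 1 / 2 ^ q := add_div ..
  linarith

theorem volume_cell_diff_middle_le (q j : ℕ) {τ : ℝ} (hτ : 0 ≤ τ) :
    volume (cell q j \ middle q j τ) ≤ ENNReal.ofReal (2 * τ) := by
  have hsub : cell q j \ middle q j τ ⊆ Set.Ico ((j : ℝ) / 2 ^ q) ((j : ℝ) / 2 ^ q + τ) ∪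
      Set.Ioc (((j : ℝ) + 1) / 2 ^ q - τ) (((j : ℝ) + 1) / 2 ^ q) := by
    rintro t ⟨h1, h2⟩
    by_cases h : t < (j : ℝ) / 2 ^ q + τ
    · exact Or.inl ⟨h1.1, h⟩
    · refine Or.inr ⟨?_, h1.2.le⟩
      by_contra h'
      exact h2 ⟨not_lt.1 h, not_lt.1 h'⟩
  refine (measure_mono hsub).trans ((measure_union_le _ _).trans (le_of_eq ?_))
  rw [Real.volume_Ico, Real.volume_Ioc, add_sub_cancel_left, sub_sub_cancel,
    ← ENNReal.ofReal_add hτ hτ, two_mul]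

section Scale

variable {E : Set Plane} {lam δ Λ : ℝ≥0∞} {D q : ℕ} {τ e u v : ℝ} {F : Finset (Plane × ℝ)}

theorem fav_clean_compact_le (hE : E ⊆ Metric.closedBall 0 1) (hEm : MeasurableSet E)
    (hD : 1 ≤ D) (hτ : τ = 1 / (D * 2 ^ q))
    (h1 : τ ≤ 1 / 4) (he : 0 < e) (hu : 0 < u) (huτ : u ≤ τ / 4)
    (hR : rectConst E e u (1 / u) ≤ δ)
    (hF : ∀ B ∈ F, u ≤ B.2 ∧ B.2 ≤ v) (hcov : E ⊆ ⋃ B ∈ F, Metric.ball B.1 B.2)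
    (hsum : ∑ B ∈ F, ENNReal.ofReal B.2 ≤ Λ) {j : ℕ} {C : Set Plane} (hC : IsCompact C)
    (hCE : C ⊆ E) (hCc : C ⊆ cleanPoints (μH[1].restrict E) lam (e / 4) (2 * v) q j) :
    fav (C ×ˢ middle q j τ) ≤ (2 * δ + 480 * (lam * D)) * Λ * volume (middle q j τ) := by
  have hS : IsCompact (lines (C ×ˢ middle q j τ)) := by
    refine (hC.prod isCompact_Icc).image ?_
    unfold pr; fun_prop
  refine volume_le_mul_of_slice_le hS.isClosed.measurableSet measurableSet_Icc ?_ fun t ht => ?_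
  · rintro _ ⟨⟨x, t⟩, hx, rfl⟩; exact hx.2
  · have hsub : {c | (c, t) ∈ lines (C ×ˢ middle q j τ)} ⊆
        ⋃ B ∈ F, (fun x => pr x t) '' (C ∩ Metric.ball B.1 B.2) := by
      rintro c ⟨⟨x, s⟩, hx, hc⟩
      simp only [Prod.mk.injEq] at hc
      obtain ⟨B, hB, hxB⟩ := Set.mem_iUnion₂.1 (hcov (hCE hx.1))
      exact Set.mem_biUnion hB ⟨x, ⟨hx.1, hxB⟩, by rw [← hc.2]; exact hc.1⟩
    calc _ ≤ ∑ B ∈ F, volume ((fun x => pr x t) '' (C ∩ Metric.ball B.1 B.2)) :=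
          (measure_mono hsub).trans (measure_biUnion_finset_le _ _)
      _ ≤ ∑ B ∈ F, (2 * δ + 480 * (lam * D)) * ENNReal.ofReal B.2 := by
          refine Finset.sum_le_sum fun B hB => ?_
          refine volume_pr_image_clean_le (μ := μH[1].restrict E) hD hτ h1
            (Icc_subset_dyad_of_mem_middle ht) Set.inter_subset_right (hF B hB).2
            (fun x hx => hCc hx.1) he hu (hF B hB).1 huτ hR
            (Set.inter_subset_left.trans hCE) hE fun A hA => ?_
          rw [Measure.restrict_apply' hEm, Set.inter_eq_left.2 hA]
          exact volume_pr_image_le_hausdorff A t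
      _ ≤ _ := by rw [← Finset.mul_sum]; gcongr

/-- Slicing needs a measurable set of lines, which compact point sets provide. Inner regularity
leaves mass below `η`, absorbed by `fav_prod_le`. -/
theorem fav_clean_le (hE : E ⊆ Metric.closedBall 0 1) (hEc : IsCompact E) (hEf : μH[1] E ≠ ∞)
    (hD : 1 ≤ D) (hτ : τ = 1 / (D * 2 ^ q))
    (h1 : τ ≤ 1 / 4) (he : 0 < e) (hu : 0 < u) (huτ : u ≤ τ / 4)
    (hR : rectConst E e u (1 / u) ≤ δ)
    (hF : ∀ B ∈ F, u ≤ B.2 ∧ B.2 ≤ v) (hcov : E ⊆ ⋃ B ∈ F, Metric.ball B.1 B.2)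
    (hsum : ∑ B ∈ F, ENNReal.ofReal B.2 ≤ Λ) (j : ℕ) {η : ℝ≥0∞} (hη : η ≠ 0) :
    fav ((E ∩ cleanPoints (μH[1].restrict E) lam (e / 4) (2 * v) q j) ×ˢ middle q j τ) ≤
      ((2 * δ + 480 * (lam * D)) * Λ + 2 * η) * volume (middle q j τ) := by
  have hEm := hEc.isClosed.measurableSet
  have : IsFiniteMeasure (μH[1].restrict E : Measure Plane) :=
    ⟨by rw [Measure.restrict_apply_univ]; exact hEf.lt_top⟩
  set G := E ∩ cleanPoints (μH[1].restrict E) lam (e / 4) (2 * v) q j with hG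
  have hGm : MeasurableSet G := hEm.inter (measurableSet_cleanPoints _ _ _ _ _ _)
  obtain ⟨C, hCG, hC, hCη⟩ := hGm.exists_isCompact_sdiff_lt
    (measure_ne_top (μH[1].restrict E) G) hη
  rw [Measure.restrict_apply' hEm, Set.inter_eq_left.2
    (Set.sdiff_subset.trans Set.inter_subset_left)] at hCη
  have e1 := fav_clean_compact_le hE hEm hD hτ h1 he hu huτ hR hF hcov hsum hC
    (hCG.trans Set.inter_subset_left) (hCG.trans Set.inter_subset_right)
  have e2 := fav_prod_le (G \ C) (Θ := middle q j τ) measurableSet_Icc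
    (measure_Icc_lt_top.ne)
  calc _ ≤ fav (C ×ˢ middle q j τ ∪ (G \ C) ×ˢ middle q j τ) := by
        refine fav_mono ?_
        rw [← Set.union_prod, Set.union_sdiff_cancel hCG]
    _ ≤ _ := fav_union_le _ _
    _ ≤ (2 * δ + 480 * (lam * D)) * Λ * volume (middle q j τ) +
        2 * (η * volume (middle q j τ)) := by
        refine add_le_add e1 (e2.trans ?_)
        gcongr
    _ = _ := by ring

theorem sum_two_pow_mul_ofReal (q : ℕ) (c : ℝ≥0∞) :
    ∑ _j ∈ Finset.range (2 ^ q), c * ENNReal.ofReal (1 / 2 ^ q) = c := by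
  rw [← Finset.mul_sum, Finset.sum_const, Finset.card_range, nsmul_eq_mul,
    ← ENNReal.ofReal_natCast, ← ENNReal.ofReal_mul (by positivity)]
  push_cast
  rw [mul_one_div_cancel (by positivity), ENNReal.ofReal_one, mul_one]

/-- The decomposition of the Favard length at one scale. -/
theorem fav_le_of_scale (hE : E ⊆ Metric.closedBall 0 1) (hEc : IsCompact E)
    (hΛ : μH[1] E ≤ Λ) (hΛf : Λ ≠ ∞) {K : ℝ≥0∞} (hK0 : K ≠ 0) (hK : K ≠ ∞)
    (hD : 1 ≤ D) (hτ : τ = 1 / (D * 2 ^ q))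
    (h1 : τ ≤ 1 / 4) (he : 0 < e) (hu : 0 < u) (huτ : u ≤ τ / 4)
    (hR : rectConst E e u (1 / u) ≤ δ)
    (hF : ∀ B ∈ F, u ≤ B.2 ∧ B.2 ≤ v) (hcov : E ⊆ ⋃ B ∈ F, Metric.ball B.1 B.2)
    (hsum : ∑ B ∈ F, ENNReal.ofReal B.2 ≤ Λ) {η : ℝ≥0∞} (hη : η ≠ 0) {P : ℕ} (hqP : q ≤ P) :
    fav (E ×ˢ Set.Ico 0 1) ≤ 150 * (Λ / K) +
      2 * ∑ j ∈ Finset.range (2 ^ q), (μH[1].restrict E)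
        {x | Bad (μH[1].restrict E) K lam (e / 4) (2 * v) q j x} * ENNReal.ofReal (1 / 2 ^ q) +
      4 * (Λ / D) + ((2 * δ + 480 * (lam * D)) * Λ + 2 * η) := by
  have hEm := hEc.isClosed.measurableSet
  have hEf : μH[1] E ≠ ∞ := ne_top_of_le_ne_top hΛf hΛ
  set μ : Measure Plane := μH[1].restrict E with hμdef
  have : IsFiniteMeasure μ := ⟨by rw [Measure.restrict_apply_univ]; exact hEf.lt_top⟩
  have hμ : μ Eᶜ = 0 := by rw [Measure.restrict_apply hEm.compl]; simp
  have hτ0 : 0 ≤ τ := by rw [hτ]; positivity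
  set W := Finset.range (2 ^ q) with hW
  set A₁ : Set (Plane × ℝ) := E ×ˢ Set.Ico 0 1 ∩ dirtySet μ K P with hA₁
  set A₂ : ℕ → Set (Plane × ℝ) :=
    fun j => (E ∩ {x | Bad μ K lam (e / 4) (2 * v) q j x}) ×ˢ cell q j with hA₂
  set A₃ : ℕ → Set (Plane × ℝ) := fun j => E ×ˢ (cell q j \ middle q j τ) with hA₃
  set A₄ : ℕ → Set (Plane × ℝ) :=
    fun j => (E ∩ cleanPoints μ lam (e / 4) (2 * v) q j) ×ˢ middle q j τ with hA₄
  have hsub : E ×ˢ Set.Ico 0 1 ⊆ A₁ ∪ (⋃ j ∈ W, A₂ j) ∪ (⋃ j ∈ W, A₃ j) ∪ ⋃ j ∈ W, A₄ j := by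
    rintro ⟨x, t⟩ ⟨hx, ht⟩
    have hj : ⌊2 ^ q * t⌋₊ ∈ W := Finset.mem_range.2 (floor_lt_two_pow q ht)
    have htc : t ∈ cell q ⌊2 ^ q * t⌋₊ := mem_cell_iff.2 ⟨ht.1, rfl⟩
    by_cases hd : Dirty μ K x P ⌊2 ^ P * t⌋₊
    · exact Or.inl (Or.inl (Or.inl ⟨⟨hx, ht⟩, hd⟩))
    -- Cleanness passes to coarser generations, so failing `Bad` can only mean small mass in the
    -- annulus.
    have hdq : ¬ Dirty μ K x q ⌊2 ^ q * t⌋₊ := fun h => hd (dirty_mono hqP h)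
    by_cases hb : Bad μ K lam (e / 4) (2 * v) q ⌊2 ^ q * t⌋₊ x
    · exact Or.inl (Or.inl (Or.inr (Set.mem_biUnion hj ⟨⟨hx, hb⟩, htc⟩)))
    by_cases hm : t ∈ middle q ⌊2 ^ q * t⌋₊ τ
    · refine Or.inr (Set.mem_biUnion hj ⟨⟨hx, fun r hr => ?_⟩, hm⟩)
      by_contra hlt
      exact hb ⟨hdq, r, hr, not_le.1 hlt⟩
    · exact Or.inl (Or.inr (Set.mem_biUnion hj ⟨hx, htc, hm⟩))
  have b₁ : fav A₁ ≤ 150 * (Λ / K) := by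
    refine (fav_dirtySet_le hK0 hK hE hμ P).trans ?_
    gcongr
    rw [Measure.restrict_apply_univ]; exact hΛ
  have b₂ : fav (⋃ j ∈ W, A₂ j) ≤ 2 * ∑ j ∈ W, μ {x | Bad μ K lam (e / 4) (2 * v) q j x} *
      ENNReal.ofReal (1 / 2 ^ q) := by
    refine (fav_biUnion_le W A₂).trans ?_
    rw [Finset.mul_sum]
    refine Finset.sum_le_sum fun j _ => ?_
    have := fav_prod_le (E ∩ {x | Bad μ K lam (e / 4) (2 * v) q j x}) (measurableSet_cell q j)
      (by rw [volume_cell]; exact ENNReal.ofReal_ne_top)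
    rwa [volume_cell, Set.inter_comm, ← Measure.restrict_apply' hEm, Set.inter_comm] at this
  have b₃ : fav (⋃ j ∈ W, A₃ j) ≤ 4 * (Λ / D) := by
    refine (fav_biUnion_le W A₃).trans ?_
    rw [← sum_two_pow_mul_ofReal q (4 * (Λ / D))]
    refine Finset.sum_le_sum fun j _ => ?_
    have hm := (measurableSet_cell q j).diff (measurableSet_Icc : MeasurableSet (middle q j τ))
    have hv := volume_cell_diff_middle_le q j hτ0
    refine (fav_prod_le E hm (ne_top_of_le_ne_top ENNReal.ofReal_ne_top hv)).trans ?_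
    calc _ ≤ 2 * (Λ * ENNReal.ofReal (2 * τ)) := by gcongr; exact hv
      _ = _ := by
        have hD0 : (0 : ℝ) < D := by exact_mod_cast hD
        have : 2 * τ = 2 * ((D : ℝ)⁻¹ * (1 / 2 ^ q)) := by rw [hτ]; field_simp
        rw [this, ENNReal.ofReal_mul (by norm_num), ENNReal.ofReal_mul (by positivity),
          ENNReal.ofReal_inv_of_pos hD0, ENNReal.ofReal_natCast, ENNReal.ofReal_ofNat,
          div_eq_mul_inv Λ]
        ring
  have b₄ : fav (⋃ j ∈ W, A₄ j) ≤ (2 * δ + 480 * (lam * D)) * Λ + 2 * η := by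
    refine (fav_biUnion_le W A₄).trans ?_
    rw [← sum_two_pow_mul_ofReal q ((2 * δ + 480 * (lam * D)) * Λ + 2 * η)]
    refine Finset.sum_le_sum fun j _ => ?_
    refine (fav_clean_le hE hEc hEf hD hτ h1 he hu huτ hR hF hcov hsum j hη).trans ?_
    gcongr
    exact volume_middle_le q j hτ0
  calc _ ≤ fav (A₁ ∪ (⋃ j ∈ W, A₂ j) ∪ (⋃ j ∈ W, A₃ j) ∪ ⋃ j ∈ W, A₄ j) := fav_mono hsub
    _ ≤ _ := fav_union_le _ _
    _ ≤ _ := add_le_add ((fav_union_le _ _).trans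
        (add_le_add ((fav_union_le _ _).trans (add_le_add b₁ b₂)) b₃)) b₄

end Scale

/-! ### Pigeonholing over the scales. -/

-- This integrates `volume_cell_le_of_bad` over the points and sums over disjoint cells; `A` stands
-- for `2K / lam`.
open Classical in
theorem sum_bad_le {E : Set Plane} (hE : IsCompact E) {μ : Measure Plane} [IsFiniteMeasure μ]
    (hμ : μ Eᶜ = 0) {K lam A : ℝ≥0∞} (h0 : lam ≠ 0) (hlam : lam ≠ ∞) (hA : 2 * K ≤ lam * A)
    (hAf : A ≠ ∞)
    {a b : ℝ} {p q P : ℕ} (hp : p ≤ q) (hq : q ≤ P) :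
    ∑ j ∈ Finset.range (2 ^ q), μ {x | Bad μ K lam a b q j x} * ENNReal.ofReal (1 / 2 ^ q) ≤
      A * (μ.prod (volume.restrict (Set.Ico (0 : ℝ) 1)))
        ((dirtySet μ K P \ dirtySet μ K p) ∪ (hitSet E a b P \ dirtySet μ K P)) := by
  set Y : Set (Plane × ℝ) :=
    (dirtySet μ K P \ dirtySet μ K p) ∪ (hitSet E a b P \ dirtySet μ K P) with hY
  have hYm : MeasurableSet Y :=
    ((measurableSet_dirtySet μ K P).diff (measurableSet_dirtySet μ K p)).union
      ((measurableSet_hitSet hE a b P).diff (measurableSet_dirtySet μ K P))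
  calc _ = ∫⁻ x, ∑ j ∈ Finset.range (2 ^ q),
        (if Bad μ K lam a b q j x then ENNReal.ofReal (1 / 2 ^ q) else 0) ∂μ := by
        rw [lintegral_finsetSum]
        · refine Finset.sum_congr rfl fun j _ => ?_
          have := lintegral_indicator_const (μ := μ) (measurableSet_bad μ K lam a b q j)
            (ENNReal.ofReal (1 / 2 ^ q))
          rw [mul_comm, ← this]
          rfl
        · intro j _
          exact Measurable.ite (measurableSet_bad μ K lam a b q j) measurable_const measurable_const
    _ ≤ ∫⁻ x, A * volume (Set.Ico 0 1 ∩ Prod.mk x ⁻¹' Y) ∂μ := by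
        refine lintegral_mono fun x => ?_
        refine sum_cell_le (measurable_prodMk_left hYm) fun j hj => ?_
        have h := volume_cell_le_of_bad hμ hp hq hj
        refine (ENNReal.mul_le_mul_iff_right h0 hlam).1 (h.trans ?_)
        rw [← mul_assoc]
        exact mul_le_mul_left hA _
    _ = _ := by
        rw [Measure.prod_apply hYm, lintegral_const_mul']
        · congr 1
          refine lintegral_congr fun x => ?_
          rw [Measure.restrict_apply (measurable_prodMk_left hYm), Set.inter_comm]
        · exact hAf

theorem exists_card_mul_le_sum {ι : Type*} {s : Finset ι} (hs : s.Nonempty) (f : ι → ℝ≥0∞) :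
    ∃ i ∈ s, s.card * f i ≤ ∑ j ∈ s, f j := by
  obtain ⟨i, hi, hmin⟩ := s.exists_min_image f hs
  exact ⟨i, hi, by simpa using Finset.card_nsmul_le_sum s f (f i) hmin⟩

theorem sum_measure_diff_le {X : Type*} [MeasurableSpace X] (ν : Measure X) {S : ℕ → Set X}
    (hS : ∀ i, MeasurableSet (S i)) {m : ℕ} (hmono : ∀ i < m, S i ⊆ S (i + 1)) :
    ∑ i ∈ Finset.range m, ν (S (i + 1) \ S i) ≤ ν (S m) := by
  induction m with
  | zero => simp
  | succ m ih =>
    rw [Finset.sum_range_succ, ← Set.union_sdiff_cancel (hmono m (Nat.lt_succ_self m)),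
      measure_union disjoint_sdiff_self_right ((hS _).diff (hS _)),
      Set.union_sdiff_cancel (hmono m (Nat.lt_succ_self m))]
    gcongr
    exact ih fun i hi => hmono i (hi.trans (Nat.lt_succ_self m))

-- After the points of multiplicity at least `k` are removed, each point is counted fewer than `k`
-- times.
open Classical in
theorem sum_measure_diff_multiple_le {X ι : Type*} [MeasurableSpace X] (ν : Measure X)
    {S : ι → Set X} (hS : ∀ i, MeasurableSet (S i)) (I : Finset ι) (k : ℕ) :
    ∑ i ∈ I, ν (S i \ {x | k ≤ (I.filter fun n => x ∈ S n).card}) ≤ k * ν Set.univ := by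
  set T : Set X := {x | k ≤ (I.filter fun n => x ∈ S n).card} with hT
  have hTm : MeasurableSet T :=
    (measurable_card_filter hS I) (MeasurableSet.of_discrete (s := {m | k ≤ m}))
  calc _ = ∫⁻ x, ∑ i ∈ I, (S i \ T).indicator (fun _ => (1 : ℝ≥0∞)) x ∂ν := by
        rw [lintegral_finsetSum _ fun i _ => measurable_const.indicator ((hS i).diff hTm)]
        refine Finset.sum_congr rfl fun i _ => ?_
        rw [lintegral_indicator ((hS i).diff hTm)]; simp
    _ ≤ ∫⁻ _, k ∂ν := by
        refine lintegral_mono fun x => ?_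
        by_cases hx : x ∈ T
        · rw [Finset.sum_eq_zero]
          · exact bot_le
          · intro i _
            exact Set.indicator_of_notMem (fun h => h.2 hx) _
        · calc _ ≤ ∑ i ∈ I, if x ∈ S i then (1 : ℝ≥0∞) else 0 := by
                refine Finset.sum_le_sum fun i _ => ?_
                rw [Set.indicator_apply]
                split_ifs with h1 h2 h2
                · exact le_rfl
                · exact absurd h1.1 h2
                · exact bot_le
                · exact le_rfl
            _ = ((I.filter fun n => x ∈ S n).card : ℝ≥0∞) := by
                rw [Finset.card_filter]; push_cast; rfl
            _ ≤ k := by exact_mod_cast (not_le.1 hx).le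
    _ = _ := by simp

/-- The 15 is the one required by `hP` in `measure_multSet_slice_le`. -/
theorem exists_level {u : ℝ} (h0 : 0 < u) (h1 : u ≤ 1) :
    ∃ p : ℕ, 1 / 2 ^ p < u / 15 ∧ u / 15 ≤ 2 * (1 / 2 ^ p) := by
  obtain ⟨n, h2, h3⟩ := exists_nat_pow_near_of_lt_one (x := u / 15) (y := (1 / 2 : ℝ))
    (by positivity) (by linarith) (by norm_num) (by norm_num)
  rw [one_div_pow] at h2 h3
  refine ⟨n + 1, h2, h3.trans (le_of_eq ?_)⟩
  rw [pow_succ]; field_simp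

/-- Here `a` is the new dirt, `b` the hits of high multiplicity and `c` those of low multiplicity.
Their contributions are at most `2D⁻⁹Λ`, `8D⁻²Λ` and `2D⁻³Λ`. -/
theorem bad_total_le {D : ℕ} (hD : 1 ≤ D) {Λ a b c : ℝ≥0∞} (ha : ((D ^ 12 + 1 : ℕ) : ℝ≥0∞) * a ≤ Λ)
    (hb : ((D ^ 6 : ℕ) : ℝ≥0∞) * b ≤ 4 * (D * Λ)) (hc : ((D ^ 12 : ℕ) : ℝ≥0∞) * c ≤ (D ^ 6 : ℕ) * Λ) :
    2 * (D : ℝ≥0∞) ^ 3 * (a + (b + c)) ≤ 12 * (Λ / D) := by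
  have hD0 : (D : ℝ≥0∞) ≠ 0 := by simp; omega
  have hDt : (D : ℝ≥0∞) ≠ ∞ := ENNReal.natCast_ne_top D
  set x : ℝ≥0∞ := (D : ℝ≥0∞)⁻¹ with hx
  have hDx : (D : ℝ≥0∞) * x = 1 := ENNReal.mul_inv_cancel hD0 hDt
  have hx1 : x ≤ 1 := by rw [hx, ENNReal.inv_le_one]; exact_mod_cast hD
  have hpow : ∀ n, (D : ℝ≥0∞) ^ n * x ^ n = 1 := fun n => by rw [← mul_pow, hDx, one_pow]
  push_cast at ha hb hc
  have ha' : a ≤ x ^ 12 * Λ := by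
    calc a = x ^ 12 * ((D : ℝ≥0∞) ^ 12 * a) := by rw [← mul_assoc, mul_comm (x ^ 12), hpow, one_mul]
      _ ≤ x ^ 12 * Λ := by
        gcongr
        refine le_trans ?_ ha
        gcongr
        exact le_self_add
  have hb' : b ≤ x ^ 6 * (4 * (D * Λ)) := by
    calc b = x ^ 6 * ((D : ℝ≥0∞) ^ 6 * b) := by rw [← mul_assoc, mul_comm (x ^ 6), hpow, one_mul]
      _ ≤ _ := by gcongr
  have hc' : c ≤ x ^ 12 * (D ^ 6 * Λ) := by
    calc c = x ^ 12 * ((D : ℝ≥0∞) ^ 12 * c) := by rw [← mul_assoc, mul_comm (x ^ 12), hpow, one_mul]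
      _ ≤ _ := by gcongr
  have h8 : x ^ 8 ≤ 1 := pow_le_one₀ bot_le hx1
  have h2 : x ^ 2 ≤ 1 := pow_le_one₀ bot_le hx1
  calc 2 * (D : ℝ≥0∞) ^ 3 * (a + (b + c))
      ≤ 2 * (D : ℝ≥0∞) ^ 3 * (x ^ 12 * Λ + (x ^ 6 * (4 * (D * Λ)) + x ^ 12 * (D ^ 6 * Λ))) := by
        gcongr
    _ = 2 * (D * x) ^ 3 * (x ^ 8) * (x * Λ) + 8 * (D * x) ^ 4 * x * (x * Λ) +
        2 * (D * x) ^ 9 * x ^ 2 * (x * Λ) := by ring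
    _ ≤ 2 * (D * x) ^ 3 * 1 * (x * Λ) + 8 * (D * x) ^ 4 * 1 * (x * Λ) +
        2 * (D * x) ^ 9 * 1 * (x * Λ) := by gcongr
    _ = 12 * (Λ / D) := by
        rw [hDx, div_eq_mul_inv, ← hx]; ring

/-- The main estimate for a well separated sequence of scales. -/
theorem fav_le_of_scales {E : Set Plane} (hE : E ⊆ Metric.closedBall 0 1) (hEc : IsCompact E)
    {Λ : ℝ≥0∞} (hΛ : μH[1] E ≤ Λ) (hΛ0 : Λ ≠ 0) (hΛf : Λ ≠ ∞) {D T : ℕ} (hD : 2 ≤ D)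
    (hT : T = D ^ 12 + 1) {u v e : ℕ → ℝ}
    (huv : ∀ n ≤ T * T, 0 < e n ∧ e n ≤ u n ∧ u n ≤ v n ∧ v n ≤ 1)
    (hsep : ∀ n < T * T, v (n + 1) * (1000 * D) ≤ e n)
    (hcov : ∀ n ≤ T * T, ∃ F : Finset (Plane × ℝ), (∀ B ∈ F, u n ≤ B.2 ∧ B.2 ≤ v n) ∧
      E ⊆ (⋃ B ∈ F, Metric.ball B.1 B.2) ∧ ∑ B ∈ F, ENNReal.ofReal B.2 ≤ Λ)
    (hR : ∀ n ≤ T * T, rectConst E (e n) (u n) (1 / u n) ≤ (D : ℝ≥0∞)⁻¹) :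
    fav (E ×ˢ Set.Ico 0 1) ≤ 1000 * (Λ / D) := by
  have hEm := hEc.isClosed.measurableSet
  have hEf : μH[1] E ≠ ∞ := ne_top_of_le_ne_top hΛf hΛ
  set μ : Measure Plane := μH[1].restrict E with hμdef
  have : IsFiniteMeasure μ := ⟨by rw [Measure.restrict_apply_univ]; exact hEf.lt_top⟩
  have hμ : μ Eᶜ = 0 := by rw [Measure.restrict_apply hEm.compl]; simp
  have hμΛ : μ Set.univ ≤ Λ := by rw [Measure.restrict_apply_univ]; exact hΛ
  have hD2 : (2 : ℝ) ≤ D := by exact_mod_cast hD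
  have hT1 : 2 ≤ T := by
    have : 0 < D ^ 12 := by positivity
    omega
  have hstep : ∀ n < T * T, v (n + 1) ≤ u n / (1000 * D) := by
    intro n hn
    rw [le_div_iff₀ (by positivity)]
    exact (hsep n hn).trans (huv n hn.le).2.1
  have hsmall : ∀ n < T * T, v (n + 1) ≤ e n / 2000 := by
    intro n hn
    have h1 := hsep n hn
    have h2 := huv (n + 1) hn
    have : 0 < v (n + 1) := by linarith
    rw [le_div_iff₀ (by norm_num)]
    nlinarith
  have hvanti : ∀ m n, m ≤ n → n ≤ T * T → v n ≤ v m := by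
    intro m n hmn
    induction n, hmn using Nat.le_induction with
    | base => exact fun _ => le_rfl
    | succ n _ ih =>
      intro hn
      have h1 := hsmall n hn
      have h2 := huv n (by omega)
      have := ih (by omega)
      linarith
  have hlev : ∀ n ≤ T * T, ∃ p : ℕ, 1 / 2 ^ p < u n / 15 ∧ u n / 15 ≤ 2 * (1 / 2 ^ p) :=
    fun n hn => exists_level ((huv n hn).1.trans_le (huv n hn).2.1)
      ((huv n hn).2.2.1.trans (huv n hn).2.2.2)
  choose! p hp1 hp2 using hlev
  have hpstep : ∀ n < T * T, p n ≤ p (n + 1) := by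
    intro n hn
    by_contra hlt
    have h1 : (1 : ℝ) / 2 ^ p n ≤ 1 / 2 ^ p (n + 1) :=
      one_div_le_one_div_of_le (by positivity) (pow_le_pow_right₀ (by norm_num) (by omega))
    have h2 := hp1 (n + 1) hn
    have h3 := hp2 n hn.le
    have h4 := hsmall n hn
    have h5 := huv n hn.le
    have h6 := huv (n + 1) hn
    have h7 : (0 : ℝ) < 1 / 2 ^ p n := by positivity
    linarith
  have hpmono : ∀ m n, m ≤ n → n ≤ T * T → p m ≤ p n := by
    intro m n hmn
    induction n, hmn using Nat.le_induction with
    | base => exact fun _ => le_rfl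
    | succ n _ ih => exact fun hn => (ih (by omega)).trans (hpstep n hn)
  set K : ℝ≥0∞ := (D : ℝ≥0∞) with hKdef
  have hK0 : K ≠ 0 := by simp [hKdef]; omega
  have hK : K ≠ ∞ := ENNReal.natCast_ne_top D
  set ν : Measure (Plane × ℝ) := μ.prod (volume.restrict (Set.Ico (0 : ℝ) 1)) with hν
  have hνu : ν Set.univ ≤ Λ := by
    rw [hν, ← Set.univ_prod_univ, Measure.prod_prod]; simpa using hμΛ
  -- choice of a block of scales on which the dirty set is almost constant
  obtain ⟨i, hi, hblock⟩ := exists_card_mul_le_sum (s := Finset.range T)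
    (Finset.nonempty_range_iff.2 (by omega))
    fun i => ν (dirtySet μ K (p ((i + 1) * T)) \ dirtySet μ K (p (i * T)))
  rw [Finset.mem_range] at hi
  have hiT : (i + 1) * T ≤ T * T := Nat.mul_le_mul_right T hi
  rw [Finset.card_range] at hblock
  have hblock' : (T : ℝ≥0∞) * ν (dirtySet μ K (p ((i + 1) * T)) \ dirtySet μ K (p (i * T))) ≤ Λ := by
    refine hblock.trans (le_trans ?_ hνu)
    refine (sum_measure_diff_le ν (S := fun i => dirtySet μ K (p (i * T)))
      (fun i => measurableSet_dirtySet μ K _) fun i hi => ?_).trans (measure_mono (Set.subset_univ _))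
    intro x hx
    exact dirty_mono (hpmono _ _ (Nat.mul_le_mul_right T (Nat.le_succ i))
      (Nat.mul_le_mul_right T hi)) hx
  set a := i * T with ha
  set b := (i + 1) * T with hb
  have hab : b = a + T := by rw [ha, hb]; ring
  set I := Finset.Ioo a b with hI
  have hIcard : I.card = D ^ 12 := by rw [hI, Nat.card_Ioo, hab, hT]; omega
  have hImem : ∀ n ∈ I, a < n ∧ n < b := fun n hn => Finset.mem_Ioo.1 hn
  -- choice of a scale in the block with few hits of low multiplicity
  obtain ⟨n, hn, hhit⟩ := exists_card_mul_le_sum (s := I)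
    (Finset.card_pos.1 (by rw [hIcard]; positivity))
    fun n => ν (hitSet E (e n / 4) (2 * v n) (p b) \
      multSet E (fun n => e n / 4) (fun n => 2 * v n) I (D ^ 6) (p b))
  rw [hIcard] at hhit
  have hhit' := hhit.trans ((sum_measure_diff_multiple_le ν
    (S := fun n => hitSet E (e n / 4) (2 * v n) (p b))
    (fun n => measurableSet_hitSet hEc _ _ _) I (D ^ 6)).trans
    (mul_le_mul_right hνu _))
  obtain ⟨han, hnb⟩ := hImem n hn
  -- The cone generation `p m` comes from the scale before the annulus, so that `u (m + 1)` is small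
  -- against the narrowed aperture `1 / (D * 2 ^ p m)`.
  obtain ⟨m, rfl⟩ : ∃ m, n = m + 1 := ⟨n - 1, by omega⟩
  have hmT : m < T * T := by omega
  -- few hits of high multiplicity
  obtain ⟨Fb, hFb, hFbcov, hFbsum⟩ := hcov b hiT
  have hmult := measure_multSet_diff_le (μ := μ) (K := K) (k := D ^ 6) (P := p b) (I := I)
    (a := fun n => e n / 4) (b := fun n => 2 * v n) hEc hμ hFb hFbcov hFbsum
    (by linarith [hp1 b hiT])
    (fun n hn => by
      have := (huv n ((hImem n hn).2.le.trans hiT)).2.2.2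
      linarith)
    (fun n hn k hk hnk => by
      have h1 := hsmall n (by have := hImem n hn; omega)
      have h2 := hvanti (n + 1) k hnk (by have := hImem k hk; omega)
      have h3 := hvanti (n + 1) b (hImem n hn).2 hiT
      have h4 := (huv n (by have := hImem n hn; omega)).1
      linarith)
  have hbad := sum_bad_le (μ := μ) hEc hμ (K := K) (lam := (K ^ 2)⁻¹) (A := 2 * K ^ 3)
    (ENNReal.inv_ne_zero.2 (ENNReal.pow_ne_top hK)) (ENNReal.inv_ne_top.2 (pow_ne_zero 2 hK0))
    (le_of_eq (by
      calc 2 * K = (K ^ 2)⁻¹ * K ^ 2 * (2 * K) := by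
            rw [ENNReal.inv_mul_cancel (pow_ne_zero 2 hK0) (ENNReal.pow_ne_top hK), one_mul]
        _ = _ := by ring))
    (ENNReal.mul_ne_top (by simp) (ENNReal.pow_ne_top hK))
    (a := e (m + 1) / 4) (b := 2 * v (m + 1)) (p := p a) (q := p m) (P := p b)
    (hpmono _ _ (by omega) (by omega)) (hpmono _ _ (by omega) hiT)
  have hY : ν ((dirtySet μ K (p b) \ dirtySet μ K (p a)) ∪
      (hitSet E (e (m + 1) / 4) (2 * v (m + 1)) (p b) \ dirtySet μ K (p b))) ≤
      ν (dirtySet μ K (p b) \ dirtySet μ K (p a)) +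
      (ν (multSet E (fun n => e n / 4) (fun n => 2 * v n) I (D ^ 6) (p b) \ dirtySet μ K (p b)) +
      ν (hitSet E (e (m + 1) / 4) (2 * v (m + 1)) (p b) \
        multSet E (fun n => e n / 4) (fun n => 2 * v n) I (D ^ 6) (p b))) := by
    refine (measure_union_le _ _).trans ?_
    gcongr
    refine (measure_mono ?_).trans (measure_union_le _ _)
    rintro x ⟨h1, h2⟩
    by_cases h3 : x ∈ multSet E (fun n => e n / 4) (fun n => 2 * v n) I (D ^ 6) (p b)
    · exact Or.inl ⟨h3, h2⟩
    · exact Or.inr ⟨h1, h3⟩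
  have hbad' := hbad.trans ((mul_le_mul_right hY _).trans
    (bad_total_le (by omega) (by rw [← hT]; exact hblock') hmult hhit'))
  obtain ⟨F, hF, hFcov, hFsum⟩ := hcov (m + 1) hmT
  have hΛD : Λ / K ≠ 0 := ENNReal.div_ne_zero.2 ⟨hΛ0, hK⟩
  obtain ⟨hpos1, hpos2, hpos3, hpos4⟩ := huv (m + 1) hmT
  obtain ⟨hpos5, hpos6, hpos7, hpos8⟩ := huv m hmT.le
  have hDτ : 1 / ((D : ℝ) * 2 ^ p m) = (1 / 2 ^ p m) / D := by field_simp
  have hτ : (1 / ((D : ℝ) * 2 ^ p m)) ≤ 1 / 4 := by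
    rw [hDτ, div_le_iff₀ (by positivity)]
    have := hp1 m hmT.le
    linarith
  have huτ : u (m + 1) ≤ 1 / ((D : ℝ) * 2 ^ p m) / 4 := by
    have h1 := hpos3.trans (hstep m hmT)
    have h2 := hp2 m hmT.le
    rw [hDτ]
    refine h1.trans ?_
    rw [div_div, div_le_div_iff₀ (by positivity) (by positivity)]
    nlinarith
  have hfinal := fav_le_of_scale hE hEc hΛ hΛf hK0 hK (lam := (K ^ 2)⁻¹) (D := D) (q := p m)
    (by omega) rfl hτ hpos1 (hpos1.trans_le hpos2) huτ (hR (m + 1) hmT) hF hFcov hFsum hΛD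
    (P := p b) (hpmono _ _ (by omega) hiT)
  refine hfinal.trans ?_
  have hKK : (K ^ 2)⁻¹ * (D : ℝ≥0∞) = K⁻¹ := by
    rw [← hKdef, pow_two, ENNReal.mul_inv (Or.inl hK0) (Or.inl hK), mul_assoc,
      ENNReal.inv_mul_cancel hK0 hK, mul_one]
  rw [hKK]
  calc _ ≤ 150 * (Λ / K) + 2 * (12 * (Λ / K)) + 4 * (Λ / K) +
        ((2 * K⁻¹ + 480 * K⁻¹) * Λ + 2 * (Λ / K)) := by gcongr
    -- 150 dirty, 24 bad, 4 boundary, 482 clean, 2 from inner regularity.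
    _ = 662 * (Λ / K) := by rw [div_eq_mul_inv]; ring
    _ ≤ _ := by gcongr; norm_num

/-! ### Extracting well separated scales, and the conclusion. -/

theorem exists_finset_cover {E : Set Plane} (hE : IsCompact E) {a b : ℝ} (ha : 0 < a) {c d : ℝ≥0∞}
    (hcd : c < d) (h : sphericalContent a b E ≤ c) :
    ∃ F : Finset (Plane × ℝ), (∀ B ∈ F, a ≤ B.2 ∧ B.2 ≤ b) ∧
      E ⊆ (⋃ B ∈ F, Metric.ball B.1 B.2) ∧ ∑ B ∈ F, ENNReal.ofReal B.2 ≤ d := by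
  obtain ⟨S, hS⟩ := iInf_lt_iff.1 (h.trans_lt hcd)
  obtain ⟨⟨-, hr, hcov⟩, hsum⟩ := iInf_lt_iff.1 hS
  obtain ⟨S', hS', hfin, hcov'⟩ := hE.elim_finite_subcover_image
    (c := fun B : Plane × ℝ => Metric.ball B.1 B.2) (fun B _ => Metric.isOpen_ball) hcov
  refine ⟨hfin.toFinset, fun B hB => hr B (hS' (hfin.mem_toFinset.1 hB)), by simpa using hcov', ?_⟩
  refine le_trans ?_ hsum.le
  calc ∑ B ∈ hfin.toFinset, ENNReal.ofReal B.2
      ≤ ∑ B ∈ hfin.toFinset, Metric.ediam (Metric.ball B.1 B.2) := by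
        refine Finset.sum_le_sum fun B hB => ?_
        have h0 : 0 ≤ B.2 := ha.le.trans (hr B (hS' (hfin.mem_toFinset.1 hB))).1
        have h1 := Metric.diam_ball_eq B.1 h0
        have h2 : Metric.ediam (Metric.ball B.1 B.2) ≠ ∞ :=
          Metric.isBounded_iff_ediam_ne_top.1 Metric.isBounded_ball
        rw [← ENNReal.ofReal_toReal h2]
        refine ENNReal.ofReal_le_ofReal ?_
        change B.2 ≤ Metric.diam _
        linarith
    _ = ∑' B : (hfin.toFinset : Set (Plane × ℝ)), Metric.ediam (Metric.ball B.1.1 B.1.2) :=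
        (Finset.tsum_subtype' _ fun B : Plane × ℝ => Metric.ediam (Metric.ball B.1 B.2)).symm
    _ ≤ _ := ENNReal.tsum_mono_subtype
        (fun B : Plane × ℝ => Metric.ediam (Metric.ball B.1 B.2)) (by simpa using hS')

theorem rplus_mul_two_pow_le {rminus rplus : ℕ → ℝ} {N : ℕ}
    (hmp : ∀ n, 1 ≤ n → n ≤ N → rminus n ≤ rplus n)
    (hsep : ∀ n, 1 ≤ n → n < N → rplus (n + 1) ≤ 1 / 2 * rminus n) {n : ℕ} (hn : 1 ≤ n) (g : ℕ)
    (hg : n + g ≤ N) : rplus (n + g) * 2 ^ g ≤ rplus n := by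
  induction g with
  | zero => simp
  | succ g ih =>
    have h1 := hsep (n + g) (by omega) (by omega)
    have h2 := hmp (n + g) (by omega) (by omega)
    have h3 := ih (by omega)
    rw [← add_assoc]
    have h4 : (0 : ℝ) < 2 ^ g := by positivity
    rw [pow_succ]
    nlinarith

theorem rminus_le_rminus {rminus rplus : ℕ → ℝ} {N : ℕ}
    (hmp : ∀ n, 1 ≤ n → n ≤ N → rminus n ≤ rplus n)
    (hchain : ∀ n, 1 ≤ n → n < N → rplus (n + 1) ≤ rminus n) {n m : ℕ} (hn : 1 ≤ n) (hnm : n ≤ m)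
    (hm : m ≤ N) : rminus m ≤ rminus n := by
  induction m, hnm using Nat.le_induction with
  | base => exact le_rfl
  | succ m hnm ih =>
    exact ((hmp _ (by omega) hm).trans (hchain m (by omega) (by omega))).trans (ih (by omega))

/-- The left side is at most `5001 * D ^ 25`, and `5001 < 2 ^ 13`; exponent 38 would already do. -/
theorem scales_fit {D : ℕ} (hD : 2 ≤ D) :
    1000 * D * ((D ^ 12 + 1) * (D ^ 12 + 1) + 1) + 1 ≤ D ^ 100 := by
  have h1 : 1 ≤ D ^ 12 := Nat.one_le_pow _ _ (by omega)
  have h2 : (D ^ 12 + 1) * (D ^ 12 + 1) + 1 ≤ 5 * D ^ 24 := by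
    have : D ^ 24 = D ^ 12 * D ^ 12 := by ring
    nlinarith
  have h3 : 2 ^ 13 ≤ D ^ 13 := Nat.pow_le_pow_left hD 13
  have h4 : 1 ≤ D ^ 25 := Nat.one_le_pow _ _ (by omega)
  calc _ ≤ 1000 * D * (5 * D ^ 24) + D ^ 25 := by gcongr
    _ = 5001 * D ^ 25 := by ring
    _ ≤ D ^ 13 * D ^ 25 := by gcongr; omega
    _ = D ^ 38 := by ring
    _ ≤ D ^ 100 := Nat.pow_le_pow_right (by omega) (by norm_num)

end Besicovitch

theorem theorem1p6 :
    ∃ C : ℝ, 0 < C ∧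
      ∀ (L : ℝ) (E : Set Besicovitch.Plane) (N : ℕ) (rminus rplus : ℕ → ℝ),
        0 < L →
        IsCompact E →
        E ⊆ Metric.closedBall 0 1 →
        Besicovitch.sphericalMeasure E ≤ ENNReal.ofReal L →
        1 ≤ N →
        -- the chain `0 < r_{N,-} ≤ r_{N,+} ≤ … ≤ r_{1,-} ≤ r_{1,+} ≤ 1`
        0 < rminus N →
        (∀ n, 1 ≤ n → n ≤ N → rminus n ≤ rplus n) →
        (∀ n, 1 ≤ n → n < N → rplus (n + 1) ≤ rminus n) →
        rplus 1 ≤ 1 →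
        -- uniform length bound
        (∀ n, 1 ≤ n → n ≤ N →
          Besicovitch.sphericalContent (rminus n) (rplus n) E ≤ ENNReal.ofReal L) →
        -- scale separation
        (∀ n, 1 ≤ n → n < N → rplus (n + 1) ≤ 1 / 2 * rminus n) →
        -- unrectifiability
        (∀ n, 1 ≤ n → n < N →
          Besicovitch.rectConst E (rplus (n + 1)) (rminus n) (1 / rminus n) ≤
            ENNReal.ofReal ((N : ℝ) ^ (-(1 / 100) : ℝ))) →
        Besicovitch.favard E ≤ ENNReal.ofReal (C * (N : ℝ) ^ (-(1 / 100) : ℝ) * L) := by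
  open Besicovitch in
  refine ⟨4000, by norm_num, ?_⟩
  intro L E N rminus rplus hL hEc hE hS hN hpos hmp hchain hr1 hcont hsep hR
  have hN1 : (1 : ℝ) ≤ N := by exact_mod_cast hN
  set x : ℝ := (N : ℝ) ^ (1 / 100 : ℝ) with hx
  have hx1 : 1 ≤ x := Real.one_le_rpow hN1 (by norm_num)
  have hxneg : (N : ℝ) ^ (-(1 / 100) : ℝ) = x⁻¹ := Real.rpow_neg (by linarith) _
  have hxpow : x ^ 100 = N := by
    rw [hx, ← Real.rpow_natCast, ← Real.rpow_mul (by linarith)]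
    norm_num
  rw [hxneg] at hR ⊢
  set D : ℕ := ⌊x⌋₊ with hDdef
  have hDx : (D : ℝ) ≤ x := Nat.floor_le (by linarith)
  have hxD : x < D + 1 := Nat.lt_floor_add_one x
  have hD1 : 1 ≤ D := Nat.one_le_floor_iff _ |>.2 hx1
  have hD1' : (1 : ℝ) ≤ D := by exact_mod_cast hD1
  have hH := hausdorffMeasure_le_of_sphericalMeasure_le hL hS
  refine (favard_le_fav hEc).trans ?_
  -- For `D = 1` the target factor `x⁻¹` exceeds 1/2, and the trivial bound by Hausdorff measure
  -- suffices.
  rcases hD1.eq_or_lt with hD | hD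
  · have h1 := fav_prod_le E (Θ := Set.Ico (0 : ℝ) 1) measurableSet_Ico (by simp)
    refine h1.trans ?_
    rw [Real.volume_Ico, sub_zero, ENNReal.ofReal_one, mul_one]
    calc 2 * μH[1] E ≤ 2 * ENNReal.ofReal (2 * L) := by gcongr
      _ = ENNReal.ofReal (4 * L) := by
          rw [← ENNReal.ofReal_ofNat 2, ← ENNReal.ofReal_mul (by norm_num)]; congr 1; ring
      _ ≤ _ := by
          refine ENNReal.ofReal_le_ofReal ?_
          have : (1 / 2 : ℝ) ≤ x⁻¹ := by
            rw [← hD] at hxD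
            rw [one_div]
            exact inv_anti₀ (by linarith) (by push_cast at hxD; linarith)
          nlinarith
  have hDN : D ^ 100 ≤ N := by
    have : (D : ℝ) ^ 100 ≤ N := by rw [← hxpow]; gcongr
    exact_mod_cast this
  set T : ℕ := D ^ 12 + 1 with hT
  -- Only every `s`-th scale is kept: the `s - 1` halvings after the scale used as `e` give the
  -- separation `2 ^ (s - 1) ≥ s`. Taking `e` to be the very next original scale matches the
  -- unrectifiability hypothesis.
  set s : ℕ := 1000 * D with hs
  have hfit : s * (T * T + 1) + 1 ≤ N := (scales_fit hD).trans hDN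
  have hidx : ∀ n ≤ T * T, 1 ≤ s * (n + 1) ∧ s * (n + 1) + 1 ≤ N := by
    intro n hn
    have h1 : s * (n + 1) ≤ s * (T * T + 1) := Nat.mul_le_mul_left s (by omega)
    have h2 : 0 < s * (n + 1) := by positivity
    omega
  have hplus1 : ∀ n, 1 ≤ n → n ≤ N → rplus n ≤ 1 := by
    intro n hn hnN
    rcases hn.eq_or_lt with h | h
    · rwa [← h]
    · obtain ⟨m, rfl⟩ : ∃ m, n = m + 1 := ⟨n - 1, by omega⟩
      have h1 := rminus_le_rminus hmp hchain le_rfl (show 1 ≤ m by omega) (by omega)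
      have h2 := hchain m (by omega) (by omega)
      have h3 := hmp 1 le_rfl hN
      linarith
  have hmain := fav_le_of_scales (Λ := ENNReal.ofReal (2 * L)) (D := D) (T := T) hE hEc hH
    (by simpa using hL) ENNReal.ofReal_ne_top hD hT
    (u := fun n => rminus (s * (n + 1))) (v := fun n => rplus (s * (n + 1)))
    (e := fun n => rplus (s * (n + 1) + 1))
    (fun n hn => by
      obtain ⟨h1, h2⟩ := hidx n hn
      refine ⟨?_, hchain _ h1 (by omega), hmp _ h1 (by omega), hplus1 _ h1 (by omega)⟩
      exact (hpos.trans_le (rminus_le_rminus hmp hchain (by omega) h2 le_rfl)).trans_le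
        (hmp _ (by omega) h2))
    (fun n hn => by
      obtain ⟨h1, h2⟩ := hidx n hn.le
      obtain ⟨h3, h4⟩ := hidx (n + 1) hn
      have hidx' : s * (n + 1 + 1) = s * (n + 1) + 1 + (s - 1) := by
        rw [Nat.mul_succ s (n + 1)]; omega
      have h5 := rplus_mul_two_pow_le hmp hsep (n := s * (n + 1) + 1) (by omega) (s - 1) (by omega)
      rw [← hidx'] at h5
      refine le_trans ?_ h5
      have h6 : (0 : ℝ) ≤ rplus (s * (n + 1 + 1)) :=
        (hpos.le.trans (rminus_le_rminus hmp hchain h3 (by omega) le_rfl)).trans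
          (hmp _ h3 (by omega))
      refine mul_le_mul_of_nonneg_left ?_ h6
      have h7 : s - 1 < 2 ^ (s - 1) := Nat.lt_two_pow_self
      have h8 : s ≤ 2 ^ (s - 1) := by omega
      exact_mod_cast h8)
    (fun n hn => by
      obtain ⟨h1, h2⟩ := hidx n hn
      refine exists_finset_cover hEc ?_ ?_ (hcont _ h1 (by omega))
      · exact hpos.trans_le (rminus_le_rminus hmp hchain h1 (by omega) le_rfl)
      · exact (ENNReal.ofReal_lt_ofReal_iff (by linarith)).2 (by linarith))
    (fun n hn => by
      obtain ⟨h1, h2⟩ := hidx n hn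
      refine (hR _ h1 (by omega)).trans ?_
      rw [← ENNReal.ofReal_natCast, ← ENNReal.ofReal_inv_of_pos (by linarith)]
      exact ENNReal.ofReal_le_ofReal (inv_anti₀ (by linarith) hDx))
  refine hmain.trans ?_
  rw [← ENNReal.ofReal_natCast, ← ENNReal.ofReal_div_of_pos (by linarith),
    ← ENNReal.ofReal_ofNat 1000, ← ENNReal.ofReal_mul (by norm_num)]
  refine ENNReal.ofReal_le_ofReal ?_
  -- Rounding `x` down loses a factor at most 2; with `Λ = 2L` and the constant 1000 this gives
  -- 4000.
  have h1 : (D : ℝ)⁻¹ ≤ 2 * x⁻¹ := by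
    rw [← div_eq_mul_inv, inv_eq_one_div, div_le_div_iff₀ (by linarith) (by linarith)]
    linarith
  calc 1000 * (2 * L / D) = 2000 * L * (D : ℝ)⁻¹ := by ring
    _ ≤ 2000 * L * (2 * x⁻¹) := by gcongr
    _ = _ := by ring
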